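/- Notation. Let $\mathcal P_1(\mathbb R)$ be the set of probability measures on $\mathbb R$ with finite first moment, and $m(\eta)=\int y\,\eta(dy)$. For $\mu,\nu\in\mathcal P_1(\mathbb R)$, $\Pi(\mu,\nu)$ is the set of couplings of $\mu$ and $\nu$; $(\pi_x)_{x\in\mathbb R}$ is the disintegration of $\pi\in\Pi(\mu,\nu)$ with respect to its first marginal, $\pi(dx,dy)=\mu(dx)\,\pi_x(dy)$; $\Pi^{\mathrm M}(\mu,\nu)$ is the set of $M\in\Pi(\mu,\nu)$ with $m(M_x)=x$ for $\mu$-a.e. $x$. Put $\mathcal W_1(\eta,\eta')=\inf_{\gamma\in\Pi(\eta,\eta')}\int|x-y|\,\gamma(dx,dy)$ and, for couplings $\pi,\pi'$ with first marginals $\mu,\mu'$, $$\mathcal{AW}_1(\pi,\pi')=\inf_{\chi\in\Pi(\mu,\mu')}\int\big(|x-x'|+\mathcal W_1(\pi_x,\pi'_{x'})\big)\,\chi(dx,dx').$$ $M\in\Pi^{\mathrm M}(\mu,\nu)$ is a martingale rearrangement coupling of $\pi\in\Pi(\mu,\nu)$ if $\mathcal{AW}_1(\pi,M)=\inf_{M'\in\Pi^{\mathrm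 M}(\mu,\nu)}\mathcal{AW}_1(\pi,M')$. Write $\mu\le_{cx}\nu$ if $\int f\,d\mu\le\int f\,d\nu$ for all convex $f:\mathbb R\to\mathbb R$; $F_\eta^{-1}(u)=\inf\{x:\eta((-\infty,x])\ge u\}$ is the quantile function, and $\eta\le_{st}\eta'$ means $F_\eta^{-1}\le F_{\eta'}^{-1}$ on $(0,1)$. The coupling $\pi\in\Pi(\mu,\nu)$ satisfies the barycentre dispersion assumption if $$\forall a\in\mathbb R,\qquad \int_{[a,\infty)}\big(x-m(\pi_x)\big)\,\mu(dx)\le 0 .$$ Exchange maps. Let $\mathfrak B$ be the set of $(y,\tilde y,\eta,\tilde\eta)\in\mathbb R^2\times\mathcal P_1(\mathbb R)^2$ with $m(\eta)<y\le\tilde y<m(\tilde\eta)$, with the trace of the product $\sigma$-algebra, where $\mathcal P_1(\mathbb R)$ carries the Borel $\sigma$-algebra of weak convergence, and put $p=\frac{m(\tilde\eta)-\tilde y}{y-m(\eta)+m(\tilde\eta)-\tilde y}\in(0,1)$. A pair of measurable maps $\beta,\tilde\beta:\mathfrak B\to\mathcal P_1(\mathbb R)$ is called an exchange pair if for every $(y,\tilde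 y,\eta,\tilde\eta)\in\mathfrak B$ the values $\theta=\beta(y,\tilde y,\eta,\tilde\eta)$ and $\tilde\theta=\tilde\beta(y,\tilde y,\eta,\tilde\eta)$ satisfy $$m(\theta)=y,\quad m(\tilde\theta)=\tilde y,\quad \eta\le_{st}\theta,\quad \tilde\theta\le_{st}\tilde\eta,\quad p\,\theta+(1-p)\,\tilde\theta=p\,\eta+(1-p)\,\tilde\eta .$$ The explicit pair $\beta_\star,\tilde\beta_\star$ is defined as follows: $\beta_\star(y,\tilde y,\eta,\tilde\eta)$ and $\tilde\beta_\star(y,\tilde y,\eta,\tilde\eta)$ are the images of the Lebesgue measure on $[0,1]$ under, respectively, $$u\mapsto \mathbf 1_{\{u<q_\star/p\}}F_{\tilde\eta}^{-1}\Big(\tfrac{1-pu-p}{1-p}\Big)+\mathbf 1_{\{u\ge q_\star/p\}}F_\eta^{-1}(u),\qquad u\mapsto \mathbf 1_{\{u<\frac{q_\star}{1-p}\}}F_\eta^{-1}\Big(\tfrac{(1-p)u}{p}\Big)+\mathbf 1_{\{u\ge\frac{q_\star}{1-p}\}}F_{\tilde\eta}^{-1}\Big(u-\tfrac{q_\star}{1-p}\Big),$$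 where $q_\star$ is the unique $q\in[0,p\wedge(1-p)]$ such that $J(q)=y$ if $p\le\frac12$, and such that $\tilde J(q)=\tilde y$ if $p>\frac12$, with $$J(q)=\int_0^{q/p}F_{\tilde\eta}^{-1}\Big(\tfrac{1-pu-p}{1-p}\Big)du+\int_{q/p}^1F_\eta^{-1}(u)\,du,\qquad \tilde J(q)=\int_0^{\frac q{1-p}}F_\eta^{-1}\Big(\tfrac{(1-p)u}{p}\Big)du+\int_0^{\frac{1-q-p}{1-p}}F_{\tilde\eta}^{-1}(u)\,du .$$ Construction of $M$. Given $\pi\in\Pi(\mu,\nu)$ and an exchange pair $(\beta,\tilde\beta)$, put $G(u)=m(\pi_{F_\mu^{-1}(u)})$, $\Delta_\pm(u)=\int_0^u(F_\mu^{-1}-G)^\pm(v)\,dv$, $\Delta_\pm^{-1}(t)=\inf\{v\in[0,1]:\Delta_\pm(v)\ge t\}$, $\mathcal U^+=\{u\in(0,1):F_\mu^{-1}(u)>G(u)\}$, $\mathcal U^-=\{u\in(0,1):F_\mu^{-1}(u)<G(u)\}$. Let $\phi(u)=\Delta_-^{-1}(\Delta_+(u))$ on $\mathcal U^+$, $\phi(u)=\Delta_+^{-1}(\Delta_-(u))$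 on $\mathcal U^-$, and $\phi(u)=u$ for all other $u\in[0,1]$. Let $$p(u)=\frac{G(\phi(u))-F_\mu^{-1}(\phi(u))}{F_\mu^{-1}(u)-G(u)+G(\phi(u))-F_\mu^{-1}(\phi(u))},$$ $A^+=\{u\in\mathcal U^+:F_\mu^{-1}(\phi(u))<G(\phi(u)),\ \phi(\phi(u))=u,\ p(\phi(u))=1-p(u)\}$ and $A^-=\{u\in\mathcal U^-:F_\mu^{-1}(\phi(u))>G(\phi(u)),\ \phi(\phi(u))=u,\ p(\phi(u))=1-p(u)\}$. With $b(u)=(F_\mu^{-1}(u),F_\mu^{-1}(\phi(u)),\pi_{F_\mu^{-1}(u)},\pi_{F_\mu^{-1}(\phi(u))})$, set $m_u=\beta(b(u))$ for $u\in A^+$, $m_u=\tilde\beta(b(\phi(u)))$ for $u\in A^-$, and $m_u=\pi_{F_\mu^{-1}(u)}$ for all other $u\in(0,1)$ (these objects are determined up to a Lebesgue-null set of $u$). Finally $$M(dx,dy)=\int_0^1\delta_{F_\mu^{-1}(u)}(dx)\,m_u(dy)\,du .$$ Theorem. Let $\mu,\nu\in\mathcal P_1(\mathbb R)$ with $\mu\le_{cx}\nu$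 and $\mu\ne\nu$, and let $\pi\in\Pi(\mu,\nu)$ satisfy the barycentre dispersion assumption. Then $(\beta_\star,\tilde\beta_\star)$ is an exchange pair, and for this pair, and indeed for every exchange pair $(\beta,\tilde\beta)$, the measure $M$ constructed above is a martingale coupling of $\mu$ and $\nu$ which is a martingale rearrangement coupling of $\pi$, with $$\inf_{M'\in\Pi^{\mathrm M}(\mu,\nu)}\mathcal{AW}_1(\pi,M')=\mathcal{AW}_1(\pi,M)=\int_{\mathbb R}\mathcal W_1(\pi_x,M_x)\,\mu(dx)=\int_{\mathbb R}\Big|\int_{\mathbb R}y\,\pi_x(dy)-x\Big|\,\mu(dx)<\infty .$$ -/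

import Mathlib

open MeasureTheory Set

noncomputable section

namespace MartRearr

/-- The disintegration `(π_x)` of a finite measure `π(dx,dy) = π_1(dx) π_x(dy)` with respect to
its first marginal (Mathlib's conditional kernel; the value `0` for infinite `π` is never used). -/
def disint (π : Measure (ℝ × ℝ)) : ℝ → Measure ℝ :=
  open Classical in
  if h : IsFiniteMeasure π then fun x => (@Measure.condKernel ℝ ℝ _ _ _ _ π h) x else fun _ => 0

/-- The mean `∫ y η(dy)`. -/
def mean (η : Measure ℝ) : ℝ := ∫ y, y ∂η

/-- `𝒫₁(ℝ)`: probability measures on the line with finite first moment. -/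
def P1 : Set (Measure ℝ) := {η | IsProbabilityMeasure η ∧ Integrable (fun x : ℝ => x) η}

/-- `Π(μ,ν)`: the couplings of `μ` and `ν`. -/
def couplings (μ ν : Measure ℝ) : Set (Measure (ℝ × ℝ)) := {π | π.fst = μ ∧ π.snd = ν}

/-- `Π^M(μ,ν)`: the martingale couplings of `μ` and `ν`. -/
def martCouplings (μ ν : Measure ℝ) : Set (Measure (ℝ × ℝ)) :=
  {M | M ∈ couplings μ ν ∧ ∀ᵐ x ∂μ, mean (disint M x) = x}

/-- The convex order on `𝒫₁(ℝ)`. A convex function is bounded below by an affine one, so its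
integrals exist in `(-∞, +∞]`; testing with the functions integrable for both measures gives the
same order. -/
def ConvexOrder (μ ν : Measure ℝ) : Prop :=
  ∀ f : ℝ → ℝ, ConvexOn ℝ univ f → Integrable f μ → Integrable f ν → ∫ x, f x ∂μ ≤ ∫ y, f y ∂ν

/-- The Wasserstein distance of index one. -/
def W1 (μ ν : Measure ℝ) : ENNReal :=
  ⨅ γ ∈ couplings μ ν, ∫⁻ z, ENNReal.ofReal |z.1 - z.2| ∂γ

/-- The adapted Wasserstein distance of index one. -/
def AW1 (π π' : Measure (ℝ × ℝ)) : ENNReal :=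
  ⨅ χ ∈ couplings π.fst π'.fst,
    ∫⁻ z, (ENNReal.ofReal |z.1 - z.2| + W1 (disint π z.1) (disint π' z.2)) ∂χ

/-- `M` is a martingale rearrangement coupling of `π ∈ Π(μ,ν)`. -/
def IsMartRearrangement (μ ν : Measure ℝ) (π M : Measure (ℝ × ℝ)) : Prop :=
  M ∈ martCouplings μ ν ∧ AW1 π M = ⨅ M' ∈ martCouplings μ ν, AW1 π M'

/-- Wiesel's barycentre dispersion assumption for a coupling `π` with first marginal `μ`. -/
def BarycentreDispersion (μ : Measure ℝ) (π : Measure (ℝ × ℝ)) : Prop :=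
  ∀ a : ℝ, ∫ x in Ici a, (x - mean (disint π x)) ∂μ ≤ 0

/-- The quantile function `F_η⁻¹(u) = inf {x | η((-∞,x]) ≥ u}`, used for `u ∈ (0,1)`. -/
def quantile (η : Measure ℝ) (u : ℝ) : ℝ := sInf {x : ℝ | u ≤ η.real (Iic x)}

/-- The stochastic order `η ≤_st η'`. -/
def StochOrder (η η' : Measure ℝ) : Prop := ∀ u ∈ Ioo (0 : ℝ) 1, quantile η u ≤ quantile η' u

/-! ### Exchanging mass between two measures -/

/-- The set `𝔅` of the `(y, y', η, η')` with `mean η < y ≤ y' < mean η'`. It carries the trace of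
the product σ-algebra; on probability measures the σ-algebra of `Measure ℝ` is the Borel σ-algebra
of weak convergence. -/
def exchDomain : Set (ℝ × ℝ × Measure ℝ × Measure ℝ) :=
  {b | b.2.2.1 ∈ P1 ∧ b.2.2.2 ∈ P1 ∧
    mean b.2.2.1 < b.1 ∧ b.1 ≤ b.2.1 ∧ b.2.1 < mean b.2.2.2}

/-- The weight `p = (x' - y') / (y - x + x' - y')`, with `x`, `x'` the means of `η`, `η'`. -/
def exchWeight (y y' : ℝ) (η η' : Measure ℝ) : ℝ :=
  (mean η' - y') / (y - mean η + mean η' - y')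

/-- `β`, `β'` are measurable maps from `𝔅` to `𝒫₁(ℝ)` that move the means of `η`, `η'` to `y`, `y'`,
monotonically in the stochastic order, keeping the mixture `p η + (1 - p) η'`. -/
structure IsExchange (β β' : ℝ × ℝ × Measure ℝ × Measure ℝ → Measure ℝ) : Prop where
  measurable_left : Measurable fun b : exchDomain => β b
  measurable_right : Measurable fun b : exchDomain => β' b
  mem_left : ∀ b ∈ exchDomain, β b ∈ P1
  mem_right : ∀ b ∈ exchDomain, β' b ∈ P1
  mean_left : ∀ y y' η η', (y, y', η, η') ∈ exchDomain → mean (β (y, y', η, η')) = y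
  mean_right : ∀ y y' η η', (y, y', η, η') ∈ exchDomain → mean (β' (y, y', η, η')) = y'
  order_left : ∀ y y' η η', (y, y', η, η') ∈ exchDomain → StochOrder η (β (y, y', η, η'))
  order_right : ∀ y y' η η', (y, y', η, η') ∈ exchDomain → StochOrder (β' (y, y', η, η')) η'
  mixture : ∀ y y' η η', (y, y', η, η') ∈ exchDomain →
    ENNReal.ofReal (exchWeight y y' η η') • β (y, y', η, η')
        + ENNReal.ofReal (1 - exchWeight y y' η η') • β' (y, y', η, η')
      = ENNReal.ofReal (exchWeight y y' η η') • η
        + ENNReal.ofReal (1 - exchWeight y y' η η') • η'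

/-- `J(q)`: the mean of `η` after its lowest mass `q` has been exchanged (`η`, `η'` having weights
`p`, `1 - p`) against the highest mass `q` of `η'`. -/
def exchJ (p : ℝ) (η η' : Measure ℝ) (q : ℝ) : ℝ :=
  (∫ u in (0 : ℝ)..(q / p), quantile η' ((1 - p * u - p) / (1 - p)))
    + ∫ u in (q / p)..1, quantile η u

/-- `J'(q)`: the mean of `η'` after the same exchange. -/
def exchJ' (p : ℝ) (η η' : Measure ℝ) (q : ℝ) : ℝ :=
  (∫ u in (0 : ℝ)..(q / (1 - p)), quantile η ((1 - p) * u / p))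
    + ∫ u in (0 : ℝ)..((1 - q - p) / (1 - p)), quantile η' u

/-- `q⋆`: the (unique) `q ∈ [0, p ∧ (1 - p)]` with `J(q) = y` if `p ≤ 1/2`,
with `J'(q) = y'` if `p > 1/2`. -/
def exchMass (y y' : ℝ) (η η' : Measure ℝ) : ℝ :=
  let p := exchWeight y y' η η'
  if p ≤ 1 / 2 then sInf {q | q ∈ Icc 0 (min p (1 - p)) ∧ exchJ p η η' q = y}
  else sInf {q | q ∈ Icc 0 (min p (1 - p)) ∧ exchJ' p η η' q = y'}

/-- The explicit map `β`. -/
def exchLeft (b : ℝ × ℝ × Measure ℝ × Measure ℝ) : Measure ℝ :=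
  let η := b.2.2.1
  let η' := b.2.2.2
  let p := exchWeight b.1 b.2.1 η η'
  let q := exchMass b.1 b.2.1 η η'
  (volume.restrict (Icc (0 : ℝ) 1)).map fun u =>
    if u < q / p then quantile η' ((1 - p * u - p) / (1 - p)) else quantile η u

/-- The explicit map `β'`. -/
def exchRight (b : ℝ × ℝ × Measure ℝ × Measure ℝ) : Measure ℝ :=
  let η := b.2.2.1
  let η' := b.2.2.2
  let p := exchWeight b.1 b.2.1 η η'
  let q := exchMass b.1 b.2.1 η η'
  (volume.restrict (Icc (0 : ℝ) 1)).map fun u =>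
    if u < q / (1 - p) then quantile η ((1 - p) * u / p) else quantile η' (u - q / (1 - p))

/-! ### The construction of the coupling `M` from `π` -/

/-- `F_μ⁻¹`, with `μ` the first marginal of `π`. -/
def quant (π : Measure (ℝ × ℝ)) (u : ℝ) : ℝ := quantile π.fst u

/-- `π_{F_μ⁻¹(u)}`. -/
def fibre (π : Measure (ℝ × ℝ)) (u : ℝ) : Measure ℝ := disint π (quant π u)

/-- `G(u) = ∫ y π_{F_μ⁻¹(u)}(dy)`. -/
def bary (π : Measure (ℝ × ℝ)) (u : ℝ) : ℝ := mean (fibre π u)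

/-- `Δ₊(u) = ∫_0^u (F_μ⁻¹ - G)⁺(v) dv`. -/
def deltaPos (π : Measure (ℝ × ℝ)) (u : ℝ) : ℝ :=
  ∫ v in (0 : ℝ)..u, max (quant π v - bary π v) 0

/-- `Δ₋(u) = ∫_0^u (F_μ⁻¹ - G)⁻(v) dv`. -/
def deltaNeg (π : Measure (ℝ × ℝ)) (u : ℝ) : ℝ :=
  ∫ v in (0 : ℝ)..u, max (bary π v - quant π v) 0

/-- The left continuous generalised inverse `t ↦ inf {v ∈ [0,1] | Δ(v) ≥ t}`. -/
def genInv (Δ : ℝ → ℝ) (t : ℝ) : ℝ := sInf {v | v ∈ Icc (0 : ℝ) 1 ∧ t ≤ Δ v}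

/-- `𝒰⁺`. -/
def UPos (π : Measure (ℝ × ℝ)) : Set ℝ := {u | u ∈ Ioo (0 : ℝ) 1 ∧ bary π u < quant π u}

/-- `𝒰⁻`. -/
def UNeg (π : Measure (ℝ × ℝ)) : Set ℝ := {u | u ∈ Ioo (0 : ℝ) 1 ∧ quant π u < bary π u}

open Classical in
/-- The map `φ`. -/
def phi (π : Measure (ℝ × ℝ)) (u : ℝ) : ℝ :=
  if u ∈ UPos π then genInv (deltaNeg π) (deltaPos π u)
  else if u ∈ UNeg π then genInv (deltaPos π) (deltaNeg π u)
  else u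

/-- The weight `p(u)`. -/
def weight (π : Measure (ℝ × ℝ)) (u : ℝ) : ℝ :=
  (bary π (phi π u) - quant π (phi π u)) /
    (quant π u - bary π u + bary π (phi π u) - quant π (phi π u))

/-- `A⁺`. -/
def APos (π : Measure (ℝ × ℝ)) : Set ℝ :=
  {u | u ∈ UPos π ∧ quant π (phi π u) < bary π (phi π u) ∧ phi π (phi π u) = u ∧
    weight π (phi π u) = 1 - weight π u}

/-- `A⁻`. -/
def ANeg (π : Measure (ℝ × ℝ)) : Set ℝ :=
  {u | u ∈ UNeg π ∧ bary π (phi π u) < quant π (phi π u) ∧ phi π (phi π u) = u ∧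
    weight π (phi π u) = 1 - weight π u}

/-- The quadruple `(F_μ⁻¹(u), F_μ⁻¹(φ(u)), π_{F_μ⁻¹(u)}, π_{F_μ⁻¹(φ(u))})`. -/
def quadruple (π : Measure (ℝ × ℝ)) (u : ℝ) : ℝ × ℝ × Measure ℝ × Measure ℝ :=
  (quant π u, quant π (phi π u), fibre π u, fibre π (phi π u))

open Classical in
/-- The family `(m_u)` obtained from `π` with the exchange maps `β`, `β'`. -/
def mKer (β β' : ℝ × ℝ × Measure ℝ × Measure ℝ → Measure ℝ) (π : Measure (ℝ × ℝ)) (u : ℝ) :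
    Measure ℝ :=
  if u ∈ APos π then β (quadruple π u)
  else if u ∈ ANeg π then β' (quadruple π (phi π u))
  else fibre π u

/-- `M(dx,dy) = ∫_0^1 δ_{F_μ⁻¹(u)}(dx) m_u(dy) du`. -/
def rearrangement (β β' : ℝ × ℝ × Measure ℝ × Measure ℝ → Measure ℝ) (π : Measure (ℝ × ℝ)) :
    Measure (ℝ × ℝ) :=
  (volume.restrict (Ioo (0 : ℝ) 1)).bind fun u =>
    (Measure.dirac (quant π u)).prod (mKer β β' π u)

/-- The full conclusion about a candidate `M`: it is a martingale rearrangement coupling of `π`, and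
`inf AW₁(π,·) = AW₁(π,M) = ∫ W₁(π_x,M_x) μ(dx) = ∫ |∫ y π_x(dy) - x| μ(dx) < ∞`. -/
def RearrangementIdentities (μ ν : Measure ℝ) (π M : Measure (ℝ × ℝ)) : Prop :=
  IsMartRearrangement μ ν π M ∧
  AW1 π M = ∫⁻ x, W1 (disint π x) (disint M x) ∂μ ∧
  ∫⁻ x, W1 (disint π x) (disint M x) ∂μ = ∫⁻ x, ENNReal.ofReal |mean (disint π x) - x| ∂μ ∧
  ∫⁻ x, ENNReal.ofReal |mean (disint π x) - x| ∂μ < ⊤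

end MartRearr

end

open MeasureTheory Set

noncomputable section

namespace MartRearr

/-! ### Quantile functions -/

section Quantile

variable {η η' : Measure ℝ} {u x : ℝ}

/-! Lower bound. Two laws are at `W1` distance at least the gap between their means. Hence for a
martingale coupling `M'` and any transport `χ` of first marginals, |x - x'| + W₁(π_x, M'_{x'}) ≥ |x
- x'| + |m(π_x) - x'| ≥ |m(π_x) - x|, and integration bounds `AW1 π M'` below by ∫ |m(π_x) - x|
μ(dx) (`le_AW1`).

Attainment. The diagonal transport gives AW₁(π, M) ≤ ∫ W₁(π_x, M_x) μ(dx), and W₁ between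
stochastically ordered laws equals the gap of means. So it suffices to find a martingale coupling
whose fibres M_x are stochastically comparable to π_x. Fibres whose barycentre is too low (`UPos`)
must be raised and those whose barycentre is too high (`UNeg`) lowered, without changing the second
marginal.

Pairing. The map φ carries the measure (F_μ⁻¹ - G)⁺ du to (F_μ⁻¹ - G)⁻ du (`map_genInv_comp`), which
is possible because both have the same mass, the means of μ and ν being equal. Thus du near u is
matched with du multiplied by the ratio of the two deficits near φ(u), exactly the proportion p(u) :
1 - p(u) of the exchange pair; preservation of the mixture then preserves ν (`setLIntegral_UNeg`,
`exchange_mass`, `lintegral_mKer`). The dispersion assumption says Δ₋ ≤ Δ₊ (`deltaNeg_le_deltaPos`),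
so u ≤ φ(u) on `UPos`; this is the condition y ≤ y' that places the quadruple in 𝔅. At an atom of μ
the law M_x averages several m_u, but all of them lie on the same side of the single law π_x, so
comparability survives (`stochOrder_disint_ae`).

Explicit pair. The lowest mass q of η is swapped with the highest mass q of η'. The mean J(q) of the
first law is continuous and concave in q, starts at m(η) < y and ends at a value ≥ y, the latter
because y ≤ y' (`le_exchJ_min`). At the least q with J(q) = y, every swap made so far replaced a
quantile by a larger one (`exchRate_nonneg`), whence the stochastic order; the claims on the second
law follow from conservation of the mixture. -/

lemma quantile_le_iff_of_nonempty [IsProbabilityMeasure η] (hu : 0 < u)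
    (hne : {x : ℝ | u ≤ η.real (Iic x)}.Nonempty) :
    quantile η u ≤ x ↔ u ≤ η.real (Iic x) := by
  have hmono : Monotone fun x => η.real (Iic x) := fun a b hab =>
    measureReal_mono (Iic_subset_Iic.2 hab)
  have hbdd : BddBelow {x : ℝ | u ≤ η.real (Iic x)} := by
    have h := (ProbabilityTheory.tendsto_cdf_atBot η).eventually (gt_mem_nhds hu)
    obtain ⟨a, ha⟩ := h.exists
    rw [ProbabilityTheory.cdf_eq_real] at ha
    refine ⟨a, fun y hy => ?_⟩
    by_contra hlt
    exact absurd (le_trans hy (hmono (le_of_not_ge hlt))) (not_le.2 ha)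
  constructor
  · intro h
    have hr : ContinuousWithinAt (ProbabilityTheory.cdf η) (Ioi x) x :=
      ((ProbabilityTheory.cdf η).right_continuous x).mono Ioi_subset_Ici_self
    rw [← ProbabilityTheory.cdf_eq_real]
    refine ge_of_tendsto hr ?_
    filter_upwards [self_mem_nhdsWithin] with y hy
    obtain ⟨z, hz, hzy⟩ := exists_lt_of_csInf_lt hne (lt_of_le_of_lt h hy)
    rw [ProbabilityTheory.cdf_eq_real]
    exact le_trans hz (hmono hzy.le)
  · intro h
    exact csInf_le hbdd h

lemma quantile_set_nonempty [IsProbabilityMeasure η] (hu : u < 1) :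
    {x : ℝ | u ≤ η.real (Iic x)}.Nonempty := by
  have h := (ProbabilityTheory.tendsto_cdf_atTop η).eventually (lt_mem_nhds hu)
  obtain ⟨a, ha⟩ := h.exists
  rw [ProbabilityTheory.cdf_eq_real] at ha
  exact ⟨a, ha.le⟩

lemma quantile_le_iff [IsProbabilityMeasure η] (hu : u ∈ Ioo (0 : ℝ) 1) :
    quantile η u ≤ x ↔ u ≤ η.real (Iic x) :=
  quantile_le_iff_of_nonempty hu.1 (quantile_set_nonempty hu.2)

lemma monotoneOn_quantile (η : Measure ℝ) [IsProbabilityMeasure η] :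
    MonotoneOn (quantile η) (Ioo 0 1) := fun _ ha _ hb hab =>
  (quantile_le_iff ha).2 (hab.trans ((quantile_le_iff hb).1 le_rfl))

lemma measurable_real_measure {Ω : Type*} [MeasurableSpace Ω] {κ : Ω → Measure ℝ}
    (hκ : Measurable κ) {s : Set ℝ} (hs : MeasurableSet s) :
    Measurable fun ω => (κ ω).real s :=
  ((Measure.measurable_coe hs).comp hκ).ennreal_toReal

/-- The quantile function is jointly measurable in the measure and the level. -/
lemma measurable_quantile_uncurry {Ω : Type*} [MeasurableSpace Ω] {κ : Ω → Measure ℝ}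
    (hκ : Measurable κ) (hp : ∀ ω, IsProbabilityMeasure (κ ω)) :
    Measurable fun z : Ω × ℝ => quantile (κ z.1) z.2 := by
  refine measurable_of_Iic fun x => ?_
  have hcdf : ∀ y : ℝ, MeasurableSet {z : Ω × ℝ | z.2 ≤ (κ z.1).real (Iic y)} := fun y =>
    measurableSet_le measurable_snd
      ((measurable_real_measure hκ measurableSet_Iic).comp measurable_fst)
  -- On S the defining set is nonempty and bounded below, so the Galois property holds. Off S it is
  -- empty or the whole line, and `sInf` takes the default value 0 in both cases.
  set S : Set (Ω × ℝ) := {z | 0 < z.2} ∩ ⋃ n : ℕ, {z | z.2 ≤ (κ z.1).real (Iic (n : ℝ))} with hS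
  have hSm : MeasurableSet S := (measurableSet_lt measurable_const measurable_snd).inter
    (MeasurableSet.iUnion fun n => hcdf n)
  have key : (fun z : Ω × ℝ => quantile (κ z.1) z.2) ⁻¹' Iic x
      = (S ∩ {z | z.2 ≤ (κ z.1).real (Iic x)}) ∪ (Sᶜ ∩ {_z | 0 ≤ x}) := by
    ext ⟨ω, u⟩
    have := hp ω
    by_cases hz : (ω, u) ∈ S
    · have hne : {x : ℝ | u ≤ (κ ω).real (Iic x)}.Nonempty := by
        obtain ⟨n, hn⟩ := mem_iUnion.1 hz.2
        exact ⟨n, hn⟩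
      simp [hz, quantile_le_iff_of_nonempty hz.1 hne]
    · have h0 : quantile (κ ω) u = 0 := by
        by_cases hu : 0 < u
        · have hemp : {x : ℝ | u ≤ (κ ω).real (Iic x)} = ∅ := by
            refine eq_empty_of_forall_notMem fun y hy => hz ⟨hu, ?_⟩
            obtain ⟨n, hn⟩ := exists_nat_ge y
            exact mem_iUnion.2 ⟨n, le_trans hy (measureReal_mono (Iic_subset_Iic.2 hn))⟩
          rw [quantile, hemp, Real.sInf_empty]
        · have huniv : {x : ℝ | u ≤ (κ ω).real (Iic x)} = univ :=
            eq_univ_of_forall fun y => (not_lt.1 hu).trans measureReal_nonneg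
          rw [quantile, huniv, Real.sInf_univ]
      simp [hz, h0]
  rw [key]
  exact (hSm.inter (hcdf x)).union (hSm.compl.inter (MeasurableSet.const _))

lemma measurable_quantile (η : Measure ℝ) [hη : IsProbabilityMeasure η] :
    Measurable (quantile η) :=
  (measurable_quantile_uncurry (κ := fun _ : Unit => η) measurable_const fun _ => hη).comp
    (measurable_const.prodMk measurable_id : Measurable fun u : ℝ => ((), u))

lemma map_quantile (η : Measure ℝ) [IsProbabilityMeasure η] :
    (volume.restrict (Ioo (0 : ℝ) 1)).map (quantile η) = η := by
  have : IsProbabilityMeasure (volume.restrict (Ioo (0 : ℝ) 1)) := ⟨by simp⟩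
  have : IsProbabilityMeasure ((volume.restrict (Ioo (0 : ℝ) 1)).map (quantile η)) :=
    Measure.isProbabilityMeasure_map (measurable_quantile η).aemeasurable
  refine Measure.ext_of_Iic _ _ fun x => ?_
  rw [Measure.map_apply (measurable_quantile η) measurableSet_Iic,
    Measure.restrict_apply (measurable_quantile η measurableSet_Iic)]
  have h1 : η.real (Iic x) ≤ 1 := measureReal_le_one
  -- The preimage is squeezed between an open and a half-open interval with the same endpoints;
  -- their common length is F_η(x).
  have hsub : Ioo 0 (η.real (Iic x)) ⊆ quantile η ⁻¹' Iic x ∩ Ioo 0 1 := fun u hu =>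
    ⟨(quantile_le_iff ⟨hu.1, hu.2.trans_le h1⟩).2 hu.2.le, hu.1, hu.2.trans_le h1⟩
  have hsup : quantile η ⁻¹' Iic x ∩ Ioo 0 1 ⊆ Ioc 0 (η.real (Iic x)) := fun u hu =>
    ⟨hu.2.1, (quantile_le_iff hu.2).1 hu.1⟩
  have hr : ENNReal.ofReal (η.real (Iic x)) = η (Iic x) := ofReal_measureReal
  refine le_antisymm ?_ ?_
  · refine (measure_mono hsup).trans_eq ?_
    rw [Real.volume_Ioc, sub_zero, hr]
  · refine le_trans (le_of_eq ?_) (measure_mono hsub)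
    rw [Real.volume_Ioo, sub_zero, hr]

lemma integrableOn_quantile (hη : η ∈ P1) : IntegrableOn (quantile η) (Ioo 0 1) := by
  have := hη.1
  have h := hη.2
  rw [← map_quantile η] at h
  exact (integrable_map_measure aestronglyMeasurable_id
    (measurable_quantile η).aemeasurable).1 h

lemma mean_eq_setIntegral_quantile [IsProbabilityMeasure η] :
    mean η = ∫ u in Ioo (0 : ℝ) 1, quantile η u := by
  conv_lhs => rw [mean, ← map_quantile η]
  exact integral_map (measurable_quantile η).aemeasurable aestronglyMeasurable_id

lemma mean_eq_intervalIntegral_quantile [IsProbabilityMeasure η] :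
    mean η = ∫ u in (0 : ℝ)..1, quantile η u := by
  rw [mean_eq_setIntegral_quantile, intervalIntegral.integral_of_le zero_le_one,
    integral_Ioc_eq_integral_Ioo]

/-- Rational thresholds suffice, so that an order between random laws can be checked outside
countably many null sets. -/
lemma stochOrder_of_rat [IsProbabilityMeasure η] [IsProbabilityMeasure η']
    (h : ∀ t : ℚ, η' (Iic (t : ℝ)) ≤ η (Iic (t : ℝ))) : StochOrder η η' := by
  intro u hu
  by_contra hlt
  obtain ⟨t, ht, ht'⟩ := exists_rat_btwn (not_le.1 hlt)
  have h1 := (quantile_le_iff hu).1 ht.le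
  have h2 : η'.real (Iic (t : ℝ)) ≤ η.real (Iic (t : ℝ)) :=
    ENNReal.toReal_mono (measure_ne_top _ _) (h t)
  exact absurd ((quantile_le_iff hu).2 (h1.trans h2)) (not_le.2 ht')

lemma StochOrder.measure_Iic_le [IsProbabilityMeasure η] [IsProbabilityMeasure η']
    (h : StochOrder η η') (t : ℝ) : η' (Iic t) ≤ η (Iic t) := by
  conv_lhs => rw [← map_quantile η']
  conv_rhs => rw [← map_quantile η]
  rw [Measure.map_apply (measurable_quantile _) measurableSet_Iic,
    Measure.map_apply (measurable_quantile _) measurableSet_Iic,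
    Measure.restrict_apply (measurable_quantile _ measurableSet_Iic),
    Measure.restrict_apply (measurable_quantile _ measurableSet_Iic)]
  exact measure_mono fun u hu => ⟨(h u hu.2).trans hu.1, hu.2⟩

end Quantile

/-! ### The Wasserstein distance -/

section Wasserstein

variable {η η' : Measure ℝ}

/-- The comonotone coupling is a competitor in the infimum. -/
lemma W1_le_lintegral_quantile [IsProbabilityMeasure η] [IsProbabilityMeasure η'] :
    W1 η η' ≤ ∫⁻ u in Ioo (0 : ℝ) 1, ENNReal.ofReal |quantile η u - quantile η' u| := by
  have hm : Measurable fun u => (quantile η u, quantile η' u) :=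
    (measurable_quantile η).prodMk (measurable_quantile η')
  have hmem : (volume.restrict (Ioo (0 : ℝ) 1)).map (fun u => (quantile η u, quantile η' u))
      ∈ couplings η η' := by
    constructor
    · rw [Measure.fst, Measure.map_map measurable_fst hm]
      exact map_quantile η
    · rw [Measure.snd, Measure.map_map measurable_snd hm]
      exact map_quantile η'
  exact (iInf₂_le _ hmem).trans (lintegral_map_le _ _)

/-- The difference of the quantile functions has a constant sign, so the absolute value can be moved
outside the integral. -/
lemma W1_le_of_stochOrder (hη : η ∈ P1) (hη' : η' ∈ P1)
    (h : StochOrder η η' ∨ StochOrder η' η) :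
    W1 η η' ≤ ENNReal.ofReal |mean η - mean η'| := by
  have := hη.1
  have := hη'.1
  have hi := integrableOn_quantile hη
  have hi' := integrableOn_quantile hη'
  refine W1_le_lintegral_quantile.trans_eq ?_
  rw [← ofReal_integral_eq_lintegral_ofReal (f := fun u => |quantile η u - quantile η' u|)
    (hi.sub hi').abs (Filter.Eventually.of_forall fun _ => abs_nonneg _)]
  congr 1
  rw [mean_eq_setIntegral_quantile, mean_eq_setIntegral_quantile, ← integral_sub hi hi']
  rcases h with h | h
  · have h1 : ∫ u in Ioo (0 : ℝ) 1, |quantile η u - quantile η' u|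
        = ∫ u in Ioo (0 : ℝ) 1, -(quantile η u - quantile η' u) :=
      setIntegral_congr_fun measurableSet_Ioo fun u hu =>
        abs_of_nonpos (sub_nonpos.2 (h u hu))
    have h2 : ∫ u in Ioo (0 : ℝ) 1, (quantile η u - quantile η' u) ≤ 0 :=
      setIntegral_nonpos measurableSet_Ioo fun u hu => sub_nonpos.2 (h u hu)
    rw [h1, integral_neg, abs_of_nonpos h2]
  · have h1 : ∫ u in Ioo (0 : ℝ) 1, |quantile η u - quantile η' u|
        = ∫ u in Ioo (0 : ℝ) 1, (quantile η u - quantile η' u) :=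
      setIntegral_congr_fun measurableSet_Ioo fun u hu =>
        abs_of_nonneg (sub_nonneg.2 (h u hu))
    have h2 : 0 ≤ ∫ u in Ioo (0 : ℝ) 1, (quantile η u - quantile η' u) :=
      setIntegral_nonneg measurableSet_Ioo fun u hu => sub_nonneg.2 (h u hu)
    rw [h1, abs_of_nonneg h2]

/-- |E(X - Y)| ≤ E|X - Y| for every coupling. -/
lemma ofReal_abs_mean_sub_le_W1 (hη : Integrable (fun x : ℝ => x) η)
    (hη' : Integrable (fun x : ℝ => x) η') :
    ENNReal.ofReal |mean η - mean η'| ≤ W1 η η' := by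
  refine le_iInf₂ fun γ hγ => ?_
  have h1 : Integrable (fun z : ℝ × ℝ => z.1) γ := by
    have := hη
    rw [← hγ.1] at this
    exact (integrable_map_measure aestronglyMeasurable_id measurable_fst.aemeasurable).1 this
  have h2 : Integrable (fun z : ℝ × ℝ => z.2) γ := by
    have := hη'
    rw [← hγ.2] at this
    exact (integrable_map_measure aestronglyMeasurable_id measurable_snd.aemeasurable).1 this
  have e1 : mean η = ∫ z, z.1 ∂γ := by
    rw [mean, ← hγ.1]
    exact integral_map measurable_fst.aemeasurable aestronglyMeasurable_id
  have e2 : mean η' = ∫ z, z.2 ∂γ := by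
    rw [mean, ← hγ.2]
    exact integral_map measurable_snd.aemeasurable aestronglyMeasurable_id
  rw [e1, e2, ← integral_sub h1 h2, ← ofReal_integral_eq_lintegral_ofReal
    (f := fun z : ℝ × ℝ => |z.1 - z.2|) (h1.sub h2).abs (Filter.Eventually.of_forall fun _ => abs_nonneg _)]
  exact ENNReal.ofReal_le_ofReal (abs_integral_le_integral_abs)

end Wasserstein

/-! ### Measurability on the space of measures -/

section Measurability

lemma measurableSet_integrable_id :
    MeasurableSet {η : Measure ℝ | Integrable (fun x : ℝ => x) η} := by
  have h : {η : Measure ℝ | Integrable (fun x : ℝ => x) η}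
      = {η | ∫⁻ x, ‖x‖ₑ ∂η < ⊤} := by
    ext η
    exact ⟨fun h => h.2, fun h => ⟨aestronglyMeasurable_id, h⟩⟩
  rw [h]
  exact measurableSet_lt (Measure.measurable_lintegral measurable_enorm) measurable_const

lemma measurableSet_P1 : MeasurableSet P1 := by
  have h : P1 = {η : Measure ℝ | η univ = 1} ∩ {η | Integrable (fun x : ℝ => x) η} := by
    ext η
    exact ⟨fun h => ⟨h.1.measure_univ, h.2⟩, fun h => ⟨⟨h.1⟩, h.2⟩⟩
  rw [h]
  exact ((Measure.measurable_coe MeasurableSet.univ) (measurableSet_singleton 1)).inter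
    measurableSet_integrable_id

lemma measurable_mean : Measurable mean := by
  classical
  -- The Bochner integral is 0 for non-integrable integrands, hence the split on a measurable set of
  -- measures.
  have h : mean = fun η : Measure ℝ =>
      if η ∈ {η : Measure ℝ | Integrable (fun x : ℝ => x) η} then
        (∫⁻ x, ENNReal.ofReal x ∂η).toReal - (∫⁻ x, ENNReal.ofReal (-x) ∂η).toReal
      else 0 := by
    ext η
    split_ifs with hη
    · exact integral_eq_lintegral_pos_part_sub_lintegral_neg_part hη
    · exact integral_undef hη
  rw [h]
  exact Measurable.ite measurableSet_integrable_id
    ((Measure.measurable_lintegral ENNReal.measurable_ofReal).ennreal_toReal.sub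
      (Measure.measurable_lintegral
        (ENNReal.measurable_ofReal.comp measurable_neg)).ennreal_toReal)
    measurable_const

lemma measurableSet_exchDomain : MeasurableSet exchDomain := by
  have h1 : Measurable fun b : ℝ × ℝ × Measure ℝ × Measure ℝ => b.1 := measurable_fst
  have h2 : Measurable fun b : ℝ × ℝ × Measure ℝ × Measure ℝ => b.2.1 :=
    measurable_fst.comp measurable_snd
  have h3 : Measurable fun b : ℝ × ℝ × Measure ℝ × Measure ℝ => b.2.2.1 :=
    measurable_fst.comp (measurable_snd.comp measurable_snd)
  have h4 : Measurable fun b : ℝ × ℝ × Measure ℝ × Measure ℝ => b.2.2.2 :=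
    measurable_snd.comp (measurable_snd.comp measurable_snd)
  exact (h3 measurableSet_P1).inter ((h4 measurableSet_P1).inter
    ((measurableSet_lt (measurable_mean.comp h3) h1).inter
      ((measurableSet_le h1 h2).inter (measurableSet_lt h2 (measurable_mean.comp h4)))))

end Measurability

/-! ### Time changes by primitives of nonnegative functions -/

section TimeChange

/-- Continuity makes the superlevel set closed, so the infimum is attained; this gives a Galois
connection between Δ and its inverse. -/
lemma genInv_le_iff {Δ : ℝ → ℝ} {t v : ℝ} (hc : ContinuousOn Δ (Icc 0 1))
    (hm : MonotoneOn Δ (Icc 0 1)) (ht : t ≤ Δ 1) (hv : v ∈ Icc (0 : ℝ) 1) :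
    genInv Δ t ≤ v ↔ t ≤ Δ v := by
  have hbdd : BddBelow {v | v ∈ Icc (0 : ℝ) 1 ∧ t ≤ Δ v} := ⟨0, fun w hw => hw.1.1⟩
  have hcl : IsClosed {v | v ∈ Icc (0 : ℝ) 1 ∧ t ≤ Δ v} :=
    hc.preimage_isClosed_of_isClosed isClosed_Icc isClosed_Ici
  have hmem : genInv Δ t ∈ {v | v ∈ Icc (0 : ℝ) 1 ∧ t ≤ Δ v} :=
    hcl.csInf_mem ⟨1, ⟨zero_le_one, le_rfl⟩, ht⟩ hbdd
  exact ⟨fun h => hmem.2.trans (hm hmem.1 hv h), fun h => csInf_le hbdd ⟨hv, h⟩⟩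

lemma genInv_mem {Δ : ℝ → ℝ} {t : ℝ} (ht : t ≤ Δ 1) : genInv Δ t ∈ Icc (0 : ℝ) 1 := by
  have hne : {v | v ∈ Icc (0 : ℝ) 1 ∧ t ≤ Δ v}.Nonempty := ⟨1, ⟨zero_le_one, le_rfl⟩, ht⟩
  have hbdd : BddBelow {v | v ∈ Icc (0 : ℝ) 1 ∧ t ≤ Δ v} := ⟨0, fun w hw => hw.1.1⟩
  exact ⟨le_csInf hne fun w hw => hw.1.1, csInf_le hbdd ⟨⟨zero_le_one, le_rfl⟩, ht⟩⟩

lemma apply_genInv {Δ : ℝ → ℝ} {t : ℝ} (hc : ContinuousOn Δ (Icc 0 1))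
    (hm : MonotoneOn Δ (Icc 0 1)) (ht : t ∈ Icc (Δ 0) (Δ 1)) : Δ (genInv Δ t) = t := by
  refine le_antisymm ?_ ((genInv_le_iff hc hm ht.2 (genInv_mem ht.2)).1 le_rfl)
  obtain ⟨w, hw, hwt⟩ := intermediate_value_Icc zero_le_one hc ht
  rw [← hwt]
  exact hm (genInv_mem (hwt ▸ ht.2)) hw
    ((genInv_le_iff hc hm (hwt ▸ ht.2) hw).2 le_rfl)

lemma monotoneOn_genInv {Δ : ℝ → ℝ} (hc : ContinuousOn Δ (Icc 0 1))
    (hm : MonotoneOn Δ (Icc 0 1)) : MonotoneOn (genInv Δ) (Iic (Δ 1)) := fun _ hs _ ht hst =>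
  (genInv_le_iff hc hm hs (genInv_mem ht)).2
    (hst.trans ((genInv_le_iff hc hm ht (genInv_mem ht)).1 le_rfl))

/-- The Lebesgue measure on the open unit interval. -/
abbrev lebUnit : Measure ℝ := volume.restrict (Ioo (0 : ℝ) 1)

instance : IsProbabilityMeasure lebUnit := ⟨by simp⟩

/-- The primitive of `f` vanishing at `0`. -/
abbrev primitive (f : ℝ → ℝ) (u : ℝ) : ℝ := ∫ v in (0 : ℝ)..u, f v

/-- The measure with density `f` on the unit interval. -/
abbrev densUnit (f : ℝ → ℝ) : Measure ℝ := lebUnit.withDensity fun u => ENNReal.ofReal (f u)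

variable {f g : ℝ → ℝ}

lemma continuousOn_primitive (hi : IntegrableOn f (Ioo 0 1)) :
    ContinuousOn (primitive f) (Icc 0 1) := by
  have h : IntegrableOn f (uIcc 0 1) := by
    rw [uIcc_of_le zero_le_one, integrableOn_Icc_iff_integrableOn_Ioo]
    exact hi
  simpa only [uIcc_of_le zero_le_one] using intervalIntegral.continuousOn_primitive_interval h

lemma intervalIntegrable_of_unit (hi : IntegrableOn f (Ioo 0 1)) {a b : ℝ}
    (ha : a ∈ Icc (0 : ℝ) 1) (hb : b ∈ Icc (0 : ℝ) 1) : IntervalIntegrable f volume a b := by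
  have h : IntervalIntegrable f volume 0 1 := by
    rw [intervalIntegrable_iff_integrableOn_Ioo_of_le zero_le_one]
    exact hi
  refine h.mono_set ?_
  rw [uIcc_of_le zero_le_one]
  exact uIcc_subset_Icc ha hb

lemma monotoneOn_primitive (h0 : ∀ u, 0 ≤ f u) (hi : IntegrableOn f (Ioo 0 1)) :
    MonotoneOn (primitive f) (Icc 0 1) := by
  intro a ha b hb hab
  have hz : (0 : ℝ) ∈ Icc (0 : ℝ) 1 := ⟨le_rfl, zero_le_one⟩
  have h := intervalIntegral.integral_add_adjacent_intervals
    (intervalIntegrable_of_unit hi hz ha) (intervalIntegrable_of_unit hi ha hb)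
  have h' : 0 ≤ ∫ v in a..b, f v := intervalIntegral.integral_nonneg hab fun u _ => h0 u
  simp only [primitive]
  linarith

lemma primitive_mem (h0 : ∀ u, 0 ≤ f u) (hi : IntegrableOn f (Ioo 0 1)) {u : ℝ}
    (hu : u ∈ Icc (0 : ℝ) 1) : primitive f u ∈ Icc (primitive f 0) (primitive f 1) :=
  ⟨monotoneOn_primitive h0 hi ⟨le_rfl, zero_le_one⟩ hu hu.1,
    monotoneOn_primitive h0 hi hu ⟨zero_le_one, le_rfl⟩ hu.2⟩

lemma isFiniteMeasure_densUnit (hi : IntegrableOn f (Ioo 0 1)) :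
    IsFiniteMeasure (densUnit f) :=
  isFiniteMeasure_withDensity_ofReal hi.2

lemma aemeasurable_genInv (h0 : ∀ u, 0 ≤ f u) (hi : IntegrableOn f (Ioo 0 1)) :
    AEMeasurable (genInv (primitive f)) (volume.restrict (Ioo 0 (primitive f 1))) :=
  aemeasurable_restrict_of_monotoneOn measurableSet_Ioo
    ((monotoneOn_genInv (continuousOn_primitive hi) (monotoneOn_primitive h0 hi)).mono
      fun _ ht => ht.2.le)

/-- The inverse of the primitive of `f` pushes the Lebesgue measure to the measure with
density `f`. -/
lemma map_genInv (h0 : ∀ u, 0 ≤ f u) (hi : IntegrableOn f (Ioo 0 1)) :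
    (volume.restrict (Ioo 0 (primitive f 1))).map (genInv (primitive f)) = densUnit f := by
  have hc := continuousOn_primitive hi
  have hm := monotoneOn_primitive h0 hi
  have := isFiniteMeasure_densUnit hi
  refine Measure.ext_of_Iic _ _ fun x => ?_
  rw [Measure.map_apply_of_aemeasurable (aemeasurable_genInv h0 hi) measurableSet_Iic,
    withDensity_apply _ measurableSet_Iic, Measure.restrict_restrict measurableSet_Iic]
  rcases lt_or_ge x 0 with hx | hx
  · have e1 : Iic x ∩ Ioo (0 : ℝ) 1 = ∅ := by
      ext v; simp only [mem_inter_iff, mem_Iic, mem_Ioo, mem_empty_iff_false, iff_false]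
      intro h; linarith [h.1, h.2.1]
    rw [e1, Measure.restrict_empty, lintegral_zero_measure, Measure.restrict_apply_eq_zero'
      measurableSet_Ioo]
    convert measure_empty (μ := (volume : Measure ℝ))
    ext t
    simp only [mem_inter_iff, mem_preimage, mem_Iic, mem_Ioo, mem_empty_iff_false, iff_false]
    intro h
    have := (genInv_mem (Δ := primitive f) h.2.2.le).1
    linarith [h.1]
  · set c := min x 1 with hcdef
    have hcI : c ∈ Icc (0 : ℝ) 1 := ⟨le_min hx zero_le_one, min_le_right _ _⟩
    have e1 : ∫⁻ v in Iic x ∩ Ioo (0 : ℝ) 1, ENNReal.ofReal (f v)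
        = ENNReal.ofReal (primitive f c) := by
      have hae : (Iic x ∩ Ioo (0 : ℝ) 1 : Set ℝ) =ᵐ[volume] Ioc 0 c := by
        have h1 : (Ioo 0 1 : Set ℝ) =ᵐ[volume] Ioc 0 1 := Ioo_ae_eq_Ioc
        have h2 := (Filter.EventuallyEq.refl (ae volume) (Iic x : Set ℝ)).inter h1
        have h3 : Iic x ∩ Ioc 0 1 = Ioc 0 c := by
          ext v
          simp only [mem_inter_iff, mem_Iic, mem_Ioc, hcdef, le_min_iff]
          tauto
        rwa [h3] at h2
      rw [setLIntegral_congr hae, primitive, intervalIntegral.integral_of_le hcI.1]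
      refine (ofReal_integral_eq_lintegral_ofReal ?_ (Filter.Eventually.of_forall h0)).symm
      exact (intervalIntegrable_iff_integrableOn_Ioc_of_le hcI.1).1
        (intervalIntegrable_of_unit hi ⟨le_rfl, zero_le_one⟩ hcI)
    rw [e1, Measure.restrict_apply' measurableSet_Ioo]
    have hpc := primitive_mem h0 hi hcI
    have hsub : Ioo 0 (primitive f c) ⊆
        genInv (primitive f) ⁻¹' Iic x ∩ Ioo 0 (primitive f 1) := fun t ht =>
      ⟨((genInv_le_iff hc hm (ht.2.le.trans hpc.2) hcI).2 ht.2.le).trans (min_le_left _ _),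
        ht.1, ht.2.trans_le hpc.2⟩
    have hsup : genInv (primitive f) ⁻¹' Iic x ∩ Ioo 0 (primitive f 1)
        ⊆ Ioc 0 (primitive f c) := fun t ht =>
      ⟨ht.2.1, (genInv_le_iff hc hm ht.2.2.le hcI).1
        (le_min ht.1 (genInv_mem ht.2.2.le).2)⟩
    refine le_antisymm ((measure_mono hsup).trans_eq ?_)
      (le_trans (le_of_eq ?_) (measure_mono hsub))
    · rw [Real.volume_Ioc, sub_zero]
    · rw [Real.volume_Ioo, sub_zero]

lemma densUnit_absolutelyContinuous : densUnit f ≪ lebUnit :=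
  withDensity_absolutelyContinuous _ _

lemma aemeasurable_primitive (hi : IntegrableOn f (Ioo 0 1)) :
    AEMeasurable (primitive f) lebUnit :=
  ((continuousOn_primitive hi).mono Ioo_subset_Icc_self).aemeasurable measurableSet_Ioo

/-- The primitive of `f` pushes the measure with density `f` to the Lebesgue measure. -/
lemma map_primitive (h0 : ∀ u, 0 ≤ f u) (hi : IntegrableOn f (Ioo 0 1)) :
    (densUnit f).map (primitive f) = volume.restrict (Ioo 0 (primitive f 1)) := by
  have hc := continuousOn_primitive hi
  have hm := monotoneOn_primitive h0 hi
  have hpm : AEMeasurable (primitive f) (densUnit f) :=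
    (aemeasurable_primitive hi).mono_ac densUnit_absolutelyContinuous
  rw [← map_genInv h0 hi] at hpm ⊢
  -- Since the density measure is the image of Lebesgue measure under the inverse, only Δ(Δ⁻¹(t)) =
  -- t is needed.
  rw [AEMeasurable.map_map_of_aemeasurable hpm (aemeasurable_genInv h0 hi)]
  conv_rhs => rw [← Measure.map_id (μ := volume.restrict (Ioo 0 (primitive f 1)))]
  refine Measure.map_congr ?_
  filter_upwards [ae_restrict_mem measurableSet_Ioo] with t ht
  have hp0 : primitive f 0 = 0 := intervalIntegral.integral_same
  exact apply_genInv hc hm ⟨hp0.trans_le ht.1.le, ht.2.le⟩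

lemma monotoneOn_genInv_comp (f0 : ∀ u, 0 ≤ f u) (fi : IntegrableOn f (Ioo 0 1))
    (g0 : ∀ u, 0 ≤ g u) (gi : IntegrableOn g (Ioo 0 1)) (hT : primitive f 1 = primitive g 1) :
    MonotoneOn (fun u => genInv (primitive g) (primitive f u)) (Icc 0 1) := fun _ ha _ hb hab =>
  monotoneOn_genInv (continuousOn_primitive gi) (monotoneOn_primitive g0 gi)
    ((primitive_mem f0 fi ha).2.trans_eq hT) ((primitive_mem f0 fi hb).2.trans_eq hT)
    (monotoneOn_primitive f0 fi ha hb hab)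

lemma aemeasurable_genInv_comp (f0 : ∀ u, 0 ≤ f u) (fi : IntegrableOn f (Ioo 0 1))
    (g0 : ∀ u, 0 ≤ g u) (gi : IntegrableOn g (Ioo 0 1)) (hT : primitive f 1 = primitive g 1) :
    AEMeasurable (fun u => genInv (primitive g) (primitive f u)) lebUnit :=
  aemeasurable_restrict_of_monotoneOn measurableSet_Ioo
    ((monotoneOn_genInv_comp f0 fi g0 gi hT).mono Ioo_subset_Icc_self)

/-- Δ⁻¹(Δ(u)) ≠ u can occur only where Δ is flat to the left of u, a set not charged by the density.
In the proof, u = Δ⁻¹(t) for a typical u, and Δ(Δ⁻¹(t)) = t. -/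
lemma genInv_primitive_ae (h0 : ∀ u, 0 ≤ f u) (hi : IntegrableOn f (Ioo 0 1)) :
    ∀ᵐ u ∂(densUnit f), genInv (primitive f) (primitive f u) = u := by
  have hc := continuousOn_primitive hi
  have hm := monotoneOn_primitive h0 hi
  have hg := aemeasurable_genInv h0 hi
  have hae : AEMeasurable (fun u => genInv (primitive f) (primitive f u)) (densUnit f) :=
    (aemeasurable_genInv_comp h0 hi h0 hi rfl).mono_ac densUnit_absolutelyContinuous
  -- A measurable representative is needed to pull an almost sure equality back through the image
  -- measure.
  obtain ⟨k, hk, h1⟩ := hae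
  have h2 : ∀ᵐ u ∂(densUnit f), k u = u := by
    rw [← map_genInv h0 hi] at h1 ⊢
    rw [ae_map_iff hg (measurableSet_eq_fun hk measurable_id')]
    filter_upwards [ae_of_ae_map hg h1, ae_restrict_mem measurableSet_Ioo] with t ht htI
    have hp0 : primitive f 0 = 0 := intervalIntegral.integral_same
    rw [← ht, apply_genInv hc hm ⟨hp0.trans_le htI.1.le, htI.2.le⟩]
  filter_upwards [h1, h2] with u hu hu'
  rw [hu, hu']

/-- Lebesgue measure on (0, T), with T the common total mass, is the intermediate step: one
primitive maps onto it, the other inverse maps out of it. -/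
lemma map_genInv_comp (f0 : ∀ u, 0 ≤ f u) (fi : IntegrableOn f (Ioo 0 1))
    (g0 : ∀ u, 0 ≤ g u) (gi : IntegrableOn g (Ioo 0 1)) (hT : primitive f 1 = primitive g 1) :
    (densUnit f).map (fun u => genInv (primitive g) (primitive f u)) = densUnit g := by
  have hpm : AEMeasurable (primitive f) (densUnit f) :=
    (aemeasurable_primitive fi).mono_ac densUnit_absolutelyContinuous
  have hg := aemeasurable_genInv g0 gi
  rw [← hT, ← map_primitive f0 fi] at hg
  have h := AEMeasurable.map_map_of_aemeasurable hg hpm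
  rw [map_primitive f0 fi, hT, map_genInv g0 gi] at h
  exact h.symm

lemma ae_densUnit_iff (hf : Measurable f) {p : ℝ → Prop} :
    (∀ᵐ u ∂(densUnit f), p u) ↔ ∀ᵐ u ∂lebUnit, 0 < f u → p u := by
  rw [ae_withDensity_iff hf.ennreal_ofReal]
  simp only [ne_eq, ENNReal.ofReal_eq_zero, not_le]

/-- With f and g the two parts of F_μ⁻¹ - G, this says that φ sends almost all of one of 𝒰⁺, 𝒰⁻ into
the other and is an involution there. -/
lemma genInv_comp_ae (hf : Measurable f) (f0 : ∀ u, 0 ≤ f u) (fi : IntegrableOn f (Ioo 0 1))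
    (hg : Measurable g) (g0 : ∀ u, 0 ≤ g u) (gi : IntegrableOn g (Ioo 0 1))
    (hT : primitive f 1 = primitive g 1) :
    ∀ᵐ u ∂lebUnit, 0 < f u →
      genInv (primitive g) (primitive f u) ∈ Ioo (0 : ℝ) 1 ∧
      0 < g (genInv (primitive g) (primitive f u)) ∧
      genInv (primitive f) (primitive g (genInv (primitive g) (primitive f u))) = u ∧
      genInv (primitive f) (primitive f u) = u := by
  have h1 : ∀ᵐ v ∂(densUnit g), v ∈ Ioo (0 : ℝ) 1 ∧ 0 < g v := by
    rw [ae_densUnit_iff hg]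
    filter_upwards [ae_restrict_mem measurableSet_Ioo] with v hv hgv
    exact ⟨hv, hgv⟩
  rw [← map_genInv_comp f0 fi g0 gi hT] at h1
  have h2 := ae_of_ae_map ((aemeasurable_genInv_comp f0 fi g0 gi hT).mono_ac
    densUnit_absolutelyContinuous) h1
  have h3 := genInv_primitive_ae f0 fi
  rw [ae_densUnit_iff hf] at h2 h3
  filter_upwards [h2, h3, ae_restrict_mem measurableSet_Ioo] with u hu hu' huI hfu
  refine ⟨(hu hfu).1, (hu hfu).2, ?_, hu' hfu⟩
  have hp : primitive f 0 = primitive g 0 := by simp [primitive]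
  have hmem := primitive_mem f0 fi (Ioo_subset_Icc_self huI)
  rw [hT, hp] at hmem
  rw [apply_genInv (continuousOn_primitive gi) (monotoneOn_primitive g0 gi) hmem, hu' hfu]

end TimeChange

/-! ### Disintegrations and barycentres -/

section Disintegration

variable {μ ν : Measure ℝ} {π : Measure (ℝ × ℝ)}

lemma isProbabilityMeasure_of_couplings (hμ : IsProbabilityMeasure μ) (hπ : π ∈ couplings μ ν) :
    IsProbabilityMeasure π := by
  refine ⟨?_⟩
  rw [← Measure.fst_univ, hπ.1]
  exact measure_univ

lemma disint_eq_condKernel [h : IsFiniteMeasure π] (x : ℝ) : disint π x = π.condKernel x := by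
  rw [disint, dif_pos h]

instance isProbabilityMeasure_disint [IsFiniteMeasure π] (x : ℝ) :
    IsProbabilityMeasure (disint π x) := by
  rw [disint_eq_condKernel]
  infer_instance

lemma measurable_disint [IsFiniteMeasure π] : Measurable (disint π) := by
  have h : disint π = π.condKernel := funext disint_eq_condKernel
  rw [h]
  exact π.condKernel.measurable

lemma measurable_mean_disint [IsFiniteMeasure π] : Measurable fun x => mean (disint π x) :=
  measurable_mean.comp measurable_disint

lemma setLIntegral_disint [IsFiniteMeasure π] {s t : Set ℝ} (hs : MeasurableSet s)
    (ht : MeasurableSet t) : ∫⁻ x in s, disint π x t ∂π.fst = π (s ×ˢ t) := by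
  simp only [disint_eq_condKernel]
  exact Measure.setLIntegral_condKernel_eq_measure_prod hs ht

lemma integrable_snd_of_couplings (hν : Integrable (fun x : ℝ => x) ν)
    (hπ : π ∈ couplings μ ν) : Integrable (fun z : ℝ × ℝ => z.2) π := by
  rw [← hπ.2] at hν
  exact (integrable_map_measure aestronglyMeasurable_id measurable_snd.aemeasurable).1 hν

lemma disint_mem_P1_ae [IsFiniteMeasure π] (h : Integrable (fun z : ℝ × ℝ => z.2) π) :
    ∀ᵐ x ∂π.fst, disint π x ∈ P1 := by
  filter_upwards [h.condKernel_ae] with x hx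
  refine ⟨inferInstance, ?_⟩
  rw [disint_eq_condKernel]
  exact hx

lemma integrable_mean_disint [IsFiniteMeasure π] (h : Integrable (fun z : ℝ × ℝ => z.2) π) :
    Integrable (fun x => mean (disint π x)) π.fst := by
  simp only [disint_eq_condKernel, mean]
  exact h.integral_condKernel

lemma setIntegral_mean_disint [IsFiniteMeasure π] (h : Integrable (fun z : ℝ × ℝ => z.2) π)
    {s : Set ℝ} (hs : MeasurableSet s) :
    ∫ x in s, mean (disint π x) ∂π.fst = ∫ z in s ×ˢ univ, z.2 ∂π := by
  simp only [disint_eq_condKernel, mean]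
  exact Measure.setIntegral_condKernel_univ_right (f := fun z : ℝ × ℝ => z.2) hs h.integrableOn

lemma integral_mean_disint [IsFiniteMeasure π] (h : Integrable (fun z : ℝ × ℝ => z.2) π) :
    ∫ x, mean (disint π x) ∂π.fst = mean π.snd := by
  have h1 := setIntegral_mean_disint h MeasurableSet.univ
  rw [univ_prod_univ, Measure.restrict_univ, Measure.restrict_univ] at h1
  rw [h1, mean, Measure.snd]
  exact (integral_map measurable_snd.aemeasurable aestronglyMeasurable_id).symm

/-- Test with x and -x. The equality of means is all that the construction takes from the convex
order. -/
lemma ConvexOrder.mean_eq (hμ : Integrable (fun x : ℝ => x) μ)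
    (hν : Integrable (fun x : ℝ => x) ν) (h : ConvexOrder μ ν) : mean μ = mean ν := by
  refine le_antisymm (h (fun x => x) (convexOn_id convex_univ) hμ hν) ?_
  have h1 := h (fun x => -x) ((concaveOn_id convex_univ).neg) hμ.neg hν.neg
  rw [integral_neg, integral_neg] at h1
  exact neg_le_neg_iff.1 h1

end Disintegration

/-! ### The map `φ` -/

section Phi

variable {μ ν : Measure ℝ} {π : Measure (ℝ × ℝ)}

/-- The hypotheses on the coupling `π`. -/
structure DispersedCoupling (μ ν : Measure ℝ) (π : Measure (ℝ × ℝ)) : Prop where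
  left_mem : μ ∈ P1
  right_mem : ν ∈ P1
  mean_eq : mean μ = mean ν
  mem : π ∈ couplings μ ν
  dispersion : BarycentreDispersion μ π

namespace DispersedCoupling

lemma isProbabilityMeasure (h : DispersedCoupling μ ν π) : IsProbabilityMeasure π :=
  isProbabilityMeasure_of_couplings h.left_mem.1 h.mem

lemma integrable_snd (h : DispersedCoupling μ ν π) : Integrable (fun z : ℝ × ℝ => z.2) π :=
  integrable_snd_of_couplings h.right_mem.2 h.mem

lemma quant_eq (h : DispersedCoupling μ ν π) : quant π = quantile μ := by
  ext u
  rw [quant, h.mem.1]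

lemma measurable_quant (h : DispersedCoupling μ ν π) : Measurable (quant π) := by
  have := h.left_mem.1
  rw [h.quant_eq]
  exact measurable_quantile μ

lemma map_quant (h : DispersedCoupling μ ν π) : lebUnit.map (quant π) = μ := by
  have := h.left_mem.1
  rw [h.quant_eq]
  exact map_quantile μ

lemma monotoneOn_quant (h : DispersedCoupling μ ν π) : MonotoneOn (quant π) (Ioo 0 1) := by
  have := h.left_mem.1
  rw [h.quant_eq]
  exact monotoneOn_quantile μ

lemma measurable_fibre (h : DispersedCoupling μ ν π) : Measurable (fibre π) := by
  have := h.isProbabilityMeasure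
  exact measurable_disint.comp h.measurable_quant

lemma isProbabilityMeasure_fibre (h : DispersedCoupling μ ν π) (u : ℝ) :
    IsProbabilityMeasure (fibre π u) := by
  have := h.isProbabilityMeasure
  exact isProbabilityMeasure_disint _

lemma measurable_bary (h : DispersedCoupling μ ν π) : Measurable (bary π) :=
  measurable_mean.comp h.measurable_fibre

lemma fibre_mem_ae (h : DispersedCoupling μ ν π) : ∀ᵐ u ∂lebUnit, fibre π u ∈ P1 := by
  have := h.isProbabilityMeasure
  have h1 := disint_mem_P1_ae h.integrable_snd
  rw [h.mem.1, ← h.map_quant] at h1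
  exact ae_of_ae_map h.measurable_quant.aemeasurable h1

/-! ### The excess x - m(π_x) and its pullback to the unit interval -/

lemma integrable_excess (h : DispersedCoupling μ ν π) :
    Integrable (fun x => x - mean (disint π x)) μ := by
  have := h.isProbabilityMeasure
  have h1 := integrable_mean_disint h.integrable_snd
  rw [h.mem.1] at h1
  exact h.left_mem.2.sub h1

lemma integral_excess (h : DispersedCoupling μ ν π) :
    ∫ x, (x - mean (disint π x)) ∂μ = 0 := by
  have := h.isProbabilityMeasure
  have h1 := integrable_mean_disint h.integrable_snd
  have h2 := integral_mean_disint h.integrable_snd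
  rw [h.mem.1] at h1 h2
  rw [integral_sub h.left_mem.2 h1, h2, h.mem.2, ← h.mean_eq, mean, sub_self]

lemma integral_excess_Iio (h : DispersedCoupling μ ν π) (a : ℝ) :
    0 ≤ ∫ x in Iio a, (x - mean (disint π x)) ∂μ := by
  have h1 := integral_add_compl (measurableSet_Iio (a := a)) h.integrable_excess
  rw [h.integral_excess, compl_Iio] at h1
  have h2 := h.dispersion a
  linarith

lemma integral_excess_Iic (h : DispersedCoupling μ ν π) (a : ℝ) :
    0 ≤ ∫ x in Iic a, (x - mean (disint π x)) ∂μ := by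
  -- The closed half-line is the decreasing intersection of open ones, for which the sign is already
  -- known.
  have hanti : Antitone fun n : ℕ => Iio (a + 1 / ((n : ℝ) + 1)) := fun m n hmn =>
    Iio_subset_Iio (by gcongr)
  have hU : ⋂ n : ℕ, Iio (a + 1 / ((n : ℝ) + 1)) = Iic a := by
    ext x
    simp only [mem_iInter, mem_Iio, mem_Iic]
    refine ⟨fun hx => ?_, fun hx n => lt_of_le_of_lt hx (by
      have : (0 : ℝ) < 1 / ((n : ℝ) + 1) := by positivity
      linarith)⟩
    by_contra hlt
    obtain ⟨n, hn⟩ := exists_nat_one_div_lt (sub_pos.2 (not_le.1 hlt))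
    linarith [hx n]
  have ht := tendsto_setIntegral_of_antitone (μ := μ) (f := fun x => x - mean (disint π x))
    (fun n : ℕ => measurableSet_Iio (a := a + 1 / ((n : ℝ) + 1))) hanti
    ⟨0, h.integrable_excess.integrableOn⟩
  rw [hU] at ht
  exact ge_of_tendsto' ht fun n => h.integral_excess_Iio _

lemma integrableOn_quant_sub_bary (h : DispersedCoupling μ ν π) :
    IntegrableOn (fun u => quant π u - bary π u) (Ioo 0 1) := by
  have h1 := h.integrable_excess
  rw [← h.map_quant] at h1
  exact h1.comp_measurable h.measurable_quant

lemma setIntegral_quant_preimage (h : DispersedCoupling μ ν π) {s : Set ℝ}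
    (hs : MeasurableSet s) :
    ∫ u in quant π ⁻¹' s ∩ Ioo 0 1, (quant π u - bary π u)
      = ∫ x in s, (x - mean (disint π x)) ∂μ := by
  have h1 := h.integrable_excess.aestronglyMeasurable
  rw [← h.map_quant] at h1
  conv_rhs => rw [← h.map_quant]
  rw [setIntegral_map hs h1 h.measurable_quant.aemeasurable,
    Measure.restrict_restrict (h.measurable_quant hs)]
  rfl

/-- The assumption controls only integrals over full level sets of F_μ⁻¹, while u may lie inside the
interval of an atom. There the integrand is constant, so the integral up to u is at least its value
at the left end of the interval if the constant is ≥ 0, and at the right end if it is ≤ 0. -/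
lemma integral_quant_sub_bary_nonneg (h : DispersedCoupling μ ν π) {u : ℝ}
    (hu : u ∈ Ioo (0 : ℝ) 1) : 0 ≤ ∫ v in (0 : ℝ)..u, (quant π v - bary π v) := by
  rw [intervalIntegral.integral_of_le hu.1.le]
  have hsub : Ioc 0 u ⊆ Ioo 0 1 := fun v hv => ⟨hv.1, hv.2.trans_lt hu.2⟩
  have hi := h.integrableOn_quant_sub_bary
  have hval : ∀ v, quant π v = quant π u → quant π v - bary π v = quant π u - bary π u := by
    intro v hv
    simp only [bary, fibre, hv]
  rcases le_total 0 (quant π u - bary π u) with hc | hc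
  · set S := quant π ⁻¹' Iio (quant π u) ∩ Ioo 0 1 with hS
    have hSm : MeasurableSet S := (h.measurable_quant measurableSet_Iio).inter measurableSet_Ioo
    have hSu : S ⊆ Ioc 0 u := fun v hv => ⟨hv.2.1, by
      by_contra hlt
      exact absurd (h.monotoneOn_quant hu hv.2 (not_le.1 hlt).le) (not_le.2 hv.1)⟩
    have h1 := setIntegral_sdiff hSm (hi.mono_set hsub) hSu
    have h2 : 0 ≤ ∫ v in S, (quant π v - bary π v) := by
      rw [hS, h.setIntegral_quant_preimage measurableSet_Iio]
      exact h.integral_excess_Iio _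
    have h3 : 0 ≤ ∫ v in Ioc 0 u \ S, (quant π v - bary π v) := by
      refine setIntegral_nonneg (measurableSet_Ioc.diff hSm) fun v hv => ?_
      rw [hval v (le_antisymm (h.monotoneOn_quant (hsub hv.1) hu hv.1.2)
        (not_lt.1 fun hlt => hv.2 ⟨hlt, hsub hv.1⟩))]
      exact hc
    linarith
  · set S := quant π ⁻¹' Iic (quant π u) ∩ Ioo 0 1 with hS
    have hSm : MeasurableSet S := (h.measurable_quant measurableSet_Iic).inter measurableSet_Ioo
    have hSu : Ioc 0 u ⊆ S := fun v hv => ⟨h.monotoneOn_quant (hsub hv) hu hv.2, hsub hv⟩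
    have h1 := setIntegral_sdiff measurableSet_Ioc (hi.mono_set (inter_subset_right : S ⊆ _)) hSu
    have h2 : 0 ≤ ∫ v in S, (quant π v - bary π v) := by
      rw [hS, h.setIntegral_quant_preimage measurableSet_Iic]
      exact h.integral_excess_Iic _
    have h3 : ∫ v in S \ Ioc 0 u, (quant π v - bary π v) ≤ 0 := by
      refine setIntegral_nonpos (hSm.diff measurableSet_Ioc) fun v hv => ?_
      have huv : u ≤ v := by
        by_contra hlt
        exact hv.2 ⟨hv.1.2.1, (not_le.1 hlt).le⟩
      rw [hval v (le_antisymm hv.1.1 (h.monotoneOn_quant hu hv.1.2 huv))]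
      exact hc
    linarith

end DispersedCoupling

/-- The positive part of `F_μ⁻¹ - G`. -/
def excessPos (π : Measure (ℝ × ℝ)) (u : ℝ) : ℝ := max (quant π u - bary π u) 0

/-- The negative part of `F_μ⁻¹ - G`. -/
def excessNeg (π : Measure (ℝ × ℝ)) (u : ℝ) : ℝ := max (bary π u - quant π u) 0

lemma excessPos_nonneg (u : ℝ) : 0 ≤ excessPos π u := le_max_right _ _

lemma excessNeg_nonneg (u : ℝ) : 0 ≤ excessNeg π u := le_max_right _ _

lemma deltaPos_eq : deltaPos π = primitive (excessPos π) := rfl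

lemma deltaNeg_eq : deltaNeg π = primitive (excessNeg π) := rfl

lemma mem_UPos_iff {u : ℝ} (hu : u ∈ Ioo (0 : ℝ) 1) : u ∈ UPos π ↔ 0 < excessPos π u := by
  simp [UPos, excessPos, hu.1, hu.2]

lemma mem_UNeg_iff {u : ℝ} (hu : u ∈ Ioo (0 : ℝ) 1) : u ∈ UNeg π ↔ 0 < excessNeg π u := by
  simp [UNeg, excessNeg, hu.1, hu.2]

lemma disjoint_UPos_UNeg : Disjoint (UPos π) (UNeg π) :=
  Set.disjoint_left.2 fun _ h h' => lt_asymm h.2 h'.2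

lemma phi_of_mem_UPos {u : ℝ} (hu : u ∈ UPos π) :
    phi π u = genInv (primitive (excessNeg π)) (primitive (excessPos π) u) := by
  rw [phi, if_pos hu]
  rfl

lemma phi_of_mem_UNeg {u : ℝ} (hu : u ∈ UNeg π) :
    phi π u = genInv (primitive (excessPos π)) (primitive (excessNeg π) u) := by
  rw [phi, if_neg (Set.disjoint_right.1 disjoint_UPos_UNeg hu), if_pos hu]
  rfl

lemma weight_phi {u : ℝ} (hu : u ∈ UPos π ∧ phi π u ∈ UNeg π ∨ u ∈ UNeg π ∧ phi π u ∈ UPos π)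
    (hphi : phi π (phi π u) = u) : weight π (phi π u) = 1 - weight π u := by
  simp only [weight, hphi]
  -- The two differences composing the denominator have the same strict sign: positive for u in 𝒰⁺,
  -- negative for u in 𝒰⁻.
  have h1 : quant π u - bary π u + bary π (phi π u) - quant π (phi π u) ≠ 0 := by
    rcases hu with ⟨h, h'⟩ | ⟨h, h'⟩
    · exact ne_of_gt (by linarith [h.2, h'.2])
    · exact ne_of_lt (by linarith [h.2, h'.2])
  have h2 : quant π (phi π u) - bary π (phi π u) + bary π u - quant π u ≠ 0 := by
    intro h0
    exact h1 (by linarith)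
  field_simp
  ring

namespace DispersedCoupling

lemma measurable_excessPos (h : DispersedCoupling μ ν π) : Measurable (excessPos π) :=
  (h.measurable_quant.sub h.measurable_bary).max measurable_const

lemma measurable_excessNeg (h : DispersedCoupling μ ν π) : Measurable (excessNeg π) :=
  (h.measurable_bary.sub h.measurable_quant).max measurable_const

lemma integrableOn_excessPos (h : DispersedCoupling μ ν π) :
    IntegrableOn (excessPos π) (Ioo 0 1) := h.integrableOn_quant_sub_bary.pos_part

lemma integrableOn_excessNeg (h : DispersedCoupling μ ν π) :
    IntegrableOn (excessNeg π) (Ioo 0 1) := by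
  have h1 := h.integrableOn_quant_sub_bary.neg_part
  simp only [neg_sub] at h1
  exact h1

lemma measurableSet_UPos (h : DispersedCoupling μ ν π) : MeasurableSet (UPos π) :=
  measurableSet_Ioo.inter (measurableSet_lt h.measurable_bary h.measurable_quant)

lemma measurableSet_UNeg (h : DispersedCoupling μ ν π) : MeasurableSet (UNeg π) :=
  measurableSet_Ioo.inter (measurableSet_lt h.measurable_quant h.measurable_bary)

lemma deltaPos_sub_deltaNeg (h : DispersedCoupling μ ν π) {u : ℝ} (hu : u ∈ Icc (0 : ℝ) 1) :
    deltaPos π u - deltaNeg π u = ∫ v in (0 : ℝ)..u, (quant π v - bary π v) := by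
  have hz : (0 : ℝ) ∈ Icc (0 : ℝ) 1 := ⟨le_rfl, zero_le_one⟩
  rw [deltaPos_eq, deltaNeg_eq, primitive, primitive, ← intervalIntegral.integral_sub
    (intervalIntegrable_of_unit h.integrableOn_excessPos hz hu)
    (intervalIntegrable_of_unit h.integrableOn_excessNeg hz hu)]
  congr 1
  ext v
  rw [excessPos, excessNeg]
  rcases le_total (quant π v) (bary π v) with hv | hv
  · rw [max_eq_right (by linarith), max_eq_left (by linarith)]; ring
  · rw [max_eq_left (by linarith), max_eq_right (by linarith)]; ring

lemma deltaPos_one (h : DispersedCoupling μ ν π) : deltaPos π 1 = deltaNeg π 1 := by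
  have h1 := h.deltaPos_sub_deltaNeg (u := 1) ⟨zero_le_one, le_rfl⟩
  have h2 := h.setIntegral_quant_preimage MeasurableSet.univ
  rw [preimage_univ, univ_inter, Measure.restrict_univ, h.integral_excess] at h2
  rw [intervalIntegral.integral_of_le zero_le_one, integral_Ioc_eq_integral_Ioo, h2] at h1
  linarith

lemma deltaNeg_le_deltaPos (h : DispersedCoupling μ ν π) {u : ℝ} (hu : u ∈ Icc (0 : ℝ) 1) :
    deltaNeg π u ≤ deltaPos π u := by
  rcases eq_or_lt_of_le hu.1 with h0 | h0
  · simp [deltaNeg, deltaPos, ← h0]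
  rcases eq_or_lt_of_le hu.2 with h1 | h1
  · rw [h1, h.deltaPos_one]
  · have h2 := h.deltaPos_sub_deltaNeg hu
    have h3 := h.integral_quant_sub_bary_nonneg ⟨h0, h1⟩
    linarith

/-- The larger function reaches the level t earlier. -/
lemma genInv_deltaPos_le (h : DispersedCoupling μ ν π) {t : ℝ} (ht : t ≤ deltaPos π 1) :
    genInv (deltaPos π) t ≤ genInv (deltaNeg π) t := by
  refine csInf_le_csInf ⟨0, fun w hw => hw.1.1⟩
    ⟨1, ⟨zero_le_one, le_rfl⟩, ht.trans_eq h.deltaPos_one⟩ fun v hv => ⟨hv.1, hv.2.trans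
      (h.deltaNeg_le_deltaPos hv.1)⟩

lemma phi_ae_UPos (h : DispersedCoupling μ ν π) : ∀ᵐ u ∂lebUnit, u ∈ UPos π →
    phi π u ∈ UNeg π ∧ phi π (phi π u) = u ∧ u ≤ phi π u := by
  filter_upwards [genInv_comp_ae h.measurable_excessPos excessPos_nonneg h.integrableOn_excessPos
    h.measurable_excessNeg excessNeg_nonneg h.integrableOn_excessNeg h.deltaPos_one,
    ae_restrict_mem measurableSet_Ioo] with u hu huI hmem
  obtain ⟨h1, h2, h3, h4⟩ := hu ((mem_UPos_iff huI).1 hmem)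
  rw [← phi_of_mem_UPos hmem] at h1 h2 h3
  have hneg := (mem_UNeg_iff h1).2 h2
  refine ⟨hneg, (phi_of_mem_UNeg hneg).trans h3, ?_⟩
  rw [phi_of_mem_UPos hmem]
  -- With u written as Δ₊⁻¹(Δ₊(u)), the claim compares the two inverses at the same level Δ₊(u).
  conv_lhs => rw [← h4]
  exact h.genInv_deltaPos_le
    (primitive_mem excessPos_nonneg h.integrableOn_excessPos (Ioo_subset_Icc_self huI)).2

lemma phi_ae_UNeg (h : DispersedCoupling μ ν π) : ∀ᵐ u ∂lebUnit, u ∈ UNeg π →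
    phi π u ∈ UPos π ∧ phi π (phi π u) = u ∧ phi π u ≤ u := by
  filter_upwards [genInv_comp_ae h.measurable_excessNeg excessNeg_nonneg h.integrableOn_excessNeg
    h.measurable_excessPos excessPos_nonneg h.integrableOn_excessPos h.deltaPos_one.symm,
    ae_restrict_mem measurableSet_Ioo] with u hu huI hmem
  obtain ⟨h1, h2, h3, h4⟩ := hu ((mem_UNeg_iff huI).1 hmem)
  rw [← phi_of_mem_UNeg hmem] at h1 h2 h3
  have hpos := (mem_UPos_iff h1).2 h2
  refine ⟨hpos, (phi_of_mem_UPos hpos).trans h3, ?_⟩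
  rw [phi_of_mem_UNeg hmem]
  conv_rhs => rw [← h4]
  refine h.genInv_deltaPos_le ?_
  rw [h.deltaPos_one]
  exact (primitive_mem excessNeg_nonneg h.integrableOn_excessNeg (Ioo_subset_Icc_self huI)).2

/-- The extra conditions in the definition of A⁺ hold almost everywhere on 𝒰⁺, so they only remove a
null set. -/
lemma mem_APos_iff_ae (h : DispersedCoupling μ ν π) :
    ∀ᵐ u ∂lebUnit, u ∈ APos π ↔ u ∈ UPos π := by
  filter_upwards [h.phi_ae_UPos] with u hu
  refine ⟨fun hA => hA.1, fun hU => ?_⟩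
  obtain ⟨h1, h2, -⟩ := hu hU
  exact ⟨hU, h1.2, h2, weight_phi (Or.inl ⟨hU, h1⟩) h2⟩

lemma mem_ANeg_iff_ae (h : DispersedCoupling μ ν π) :
    ∀ᵐ u ∂lebUnit, u ∈ ANeg π ↔ u ∈ UNeg π := by
  filter_upwards [h.phi_ae_UNeg] with u hu
  refine ⟨fun hA => hA.1, fun hU => ?_⟩
  obtain ⟨h1, h2, -⟩ := hu hU
  exact ⟨hU, h1.2, h2, weight_phi (Or.inr ⟨hU, h1⟩) h2⟩

lemma aemeasurable_phi_UPos (h : DispersedCoupling μ ν π) :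
    AEMeasurable (phi π) (lebUnit.restrict (UPos π)) := by
  have h1 := (aemeasurable_genInv_comp excessPos_nonneg h.integrableOn_excessPos
    excessNeg_nonneg h.integrableOn_excessNeg h.deltaPos_one).mono_measure
    (Measure.restrict_le_self (s := UPos π))
  refine h1.congr ?_
  filter_upwards [ae_restrict_mem h.measurableSet_UPos] with u hu
  exact (phi_of_mem_UPos hu).symm

lemma aemeasurable_phi_UNeg (h : DispersedCoupling μ ν π) :
    AEMeasurable (phi π) (lebUnit.restrict (UNeg π)) := by
  have h1 := (aemeasurable_genInv_comp excessNeg_nonneg h.integrableOn_excessNeg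
    excessPos_nonneg h.integrableOn_excessPos h.deltaPos_one.symm).mono_measure
    (Measure.restrict_le_self (s := UNeg π))
  refine h1.congr ?_
  filter_upwards [ae_restrict_mem h.measurableSet_UNeg] with u hu
  exact (phi_of_mem_UNeg hu).symm

/-- The change of variables `φ` between `𝒰⁺` and `𝒰⁻`. -/
lemma setLIntegral_UNeg (h : DispersedCoupling μ ν π) {H : ℝ → ENNReal}
    (hH : AEMeasurable H lebUnit) :
    ∫⁻ u in UNeg π, H u ∂lebUnit = ∫⁻ u in UPos π, ENNReal.ofReal (excessPos π u) *
      (H (phi π u) / ENNReal.ofReal (excessNeg π (phi π u))) ∂lebUnit := by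
  have hm := h.measurable_excessNeg.ennreal_ofReal
  have hm' := h.measurable_excessPos.ennreal_ofReal
  have hHd : AEMeasurable (fun v => H v / ENNReal.ofReal (excessNeg π v)) lebUnit :=
    hH.div hm.aemeasurable
  -- Dividing by the density, positive on 𝒰⁻, turns the integral into one against the measure that φ
  -- transports.
  have e1 : ∫⁻ u in UNeg π, H u ∂lebUnit
      = ∫⁻ v, H v / ENNReal.ofReal (excessNeg π v) ∂(densUnit (excessNeg π)) := by
    rw [densUnit, lintegral_withDensity_eq_lintegral_mul₀ hm.aemeasurable hHd,
      ← lintegral_indicator h.measurableSet_UNeg]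
    refine lintegral_congr_ae ?_
    filter_upwards [ae_restrict_mem measurableSet_Ioo] with v hv
    by_cases hvU : v ∈ UNeg π
    · have hpos := (mem_UNeg_iff hv).1 hvU
      rw [indicator_of_mem hvU, Pi.mul_apply, ENNReal.mul_div_cancel
        (ENNReal.ofReal_pos.2 hpos).ne' ENNReal.ofReal_ne_top]
    · have hz : excessNeg π v = 0 :=
        le_antisymm (not_lt.1 fun hlt => hvU ((mem_UNeg_iff hv).2 hlt)) (excessNeg_nonneg v)
      rw [indicator_of_notMem hvU, Pi.mul_apply, hz, ENNReal.ofReal_zero, zero_mul]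
  have hphi : AEMeasurable (fun u => genInv (primitive (excessNeg π))
      (primitive (excessPos π) u)) (densUnit (excessPos π)) :=
    (aemeasurable_genInv_comp excessPos_nonneg h.integrableOn_excessPos
      excessNeg_nonneg h.integrableOn_excessNeg h.deltaPos_one).mono_ac
      densUnit_absolutelyContinuous
  have hHd' := hHd.mono_ac (densUnit_absolutelyContinuous (f := excessNeg π))
  have hmap := map_genInv_comp excessPos_nonneg h.integrableOn_excessPos
    excessNeg_nonneg h.integrableOn_excessNeg h.deltaPos_one
  rw [e1]
  rw [← hmap] at hHd' ⊢
  rw [lintegral_map' hHd' hphi]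
  refine (lintegral_withDensity_eq_lintegral_mul₀' hm'.aemeasurable
    (hHd'.comp_aemeasurable hphi)).trans ?_
  rw [← lintegral_indicator h.measurableSet_UPos]
  refine lintegral_congr_ae ?_
  filter_upwards [ae_restrict_mem measurableSet_Ioo] with v hv
  by_cases hvU : v ∈ UPos π
  · rw [indicator_of_mem hvU, Pi.mul_apply, phi_of_mem_UPos hvU]
    rfl
  · have hz : excessPos π v = 0 :=
      le_antisymm (not_lt.1 fun hlt => hvU ((mem_UPos_iff hv).2 hlt)) (excessPos_nonneg v)
    rw [indicator_of_notMem hvU, Pi.mul_apply, hz, ENNReal.ofReal_zero, zero_mul]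

end DispersedCoupling

end Phi

/-! ### The rearranged coupling -/

section Rearrangement

variable {μ ν : Measure ℝ} {π : Measure (ℝ × ℝ)}
  {β β' : ℝ × ℝ × Measure ℝ × Measure ℝ → Measure ℝ}

namespace DispersedCoupling

/-- Within 𝒰⁺, preimages of null sets under φ are null: the measure with density (F_μ⁻¹ - G)⁺ is
carried to an absolutely continuous one. -/
lemma comp_phi_ae_UPos (h : DispersedCoupling μ ν π) {P : ℝ → Prop}
    (hP : ∀ᵐ u ∂lebUnit, P u) : ∀ᵐ u ∂lebUnit, u ∈ UPos π → P (phi π u) := by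
  have h1 := (densUnit_absolutelyContinuous (f := excessNeg π)).ae_le hP
  rw [← map_genInv_comp excessPos_nonneg h.integrableOn_excessPos
    excessNeg_nonneg h.integrableOn_excessNeg h.deltaPos_one] at h1
  have h2 := ae_of_ae_map ((aemeasurable_genInv_comp excessPos_nonneg h.integrableOn_excessPos
    excessNeg_nonneg h.integrableOn_excessNeg h.deltaPos_one).mono_ac
    densUnit_absolutelyContinuous) h1
  rw [ae_densUnit_iff h.measurable_excessPos] at h2
  filter_upwards [h2, ae_restrict_mem measurableSet_Ioo] with u hu huI hmem
  rw [phi_of_mem_UPos hmem]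
  exact hu ((mem_UPos_iff huI).1 hmem)

lemma comp_phi_ae_UNeg (h : DispersedCoupling μ ν π) {P : ℝ → Prop}
    (hP : ∀ᵐ u ∂lebUnit, P u) : ∀ᵐ u ∂lebUnit, u ∈ UNeg π → P (phi π u) := by
  have h1 := (densUnit_absolutelyContinuous (f := excessPos π)).ae_le hP
  rw [← map_genInv_comp excessNeg_nonneg h.integrableOn_excessNeg
    excessPos_nonneg h.integrableOn_excessPos h.deltaPos_one.symm] at h1
  have h2 := ae_of_ae_map ((aemeasurable_genInv_comp excessNeg_nonneg h.integrableOn_excessNeg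
    excessPos_nonneg h.integrableOn_excessPos h.deltaPos_one.symm).mono_ac
    densUnit_absolutelyContinuous) h1
  rw [ae_densUnit_iff h.measurable_excessNeg] at h2
  filter_upwards [h2, ae_restrict_mem measurableSet_Ioo] with u hu huI hmem
  rw [phi_of_mem_UNeg hmem]
  exact hu ((mem_UNeg_iff huI).1 hmem)

/-- The inequality u ≤ φ(u) enters here, through monotonicity of F_μ⁻¹, to give y ≤ y'. -/
lemma quadruple_mem_ae (h : DispersedCoupling μ ν π) :
    ∀ᵐ u ∂lebUnit, u ∈ UPos π → quadruple π u ∈ exchDomain := by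
  filter_upwards [h.fibre_mem_ae, h.comp_phi_ae_UPos h.fibre_mem_ae, h.phi_ae_UPos]
    with u h1 h2 h3 hu
  obtain ⟨h4, -, h5⟩ := h3 hu
  exact ⟨h1, h2 hu, hu.2, h.monotoneOn_quant hu.1 h4.1 h5, h4.2⟩

lemma quadruple_phi_mem_ae (h : DispersedCoupling μ ν π) :
    ∀ᵐ u ∂lebUnit, u ∈ UNeg π → quadruple π (phi π u) ∈ exchDomain := by
  filter_upwards [h.comp_phi_ae_UNeg h.quadruple_mem_ae, h.phi_ae_UNeg] with u h1 h2 hu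
  exact h1 hu (h2 hu).1

lemma mKer_ae_UPos (h : DispersedCoupling μ ν π) :
    ∀ᵐ u ∂lebUnit, u ∈ UPos π → mKer β β' π u = β (quadruple π u) := by
  filter_upwards [h.mem_APos_iff_ae] with u hu hU
  rw [mKer, if_pos (hu.2 hU)]

lemma mKer_ae_UNeg (h : DispersedCoupling μ ν π) :
    ∀ᵐ u ∂lebUnit, u ∈ UNeg π → mKer β β' π u = β' (quadruple π (phi π u)) := by
  filter_upwards [h.mem_ANeg_iff_ae] with u hu hU
  rw [mKer, if_neg fun hA => Set.disjoint_left.1 disjoint_UPos_UNeg hA.1 hU, if_pos (hu.2 hU)]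

lemma mKer_of_notMem {u : ℝ} (hu : u ∉ UPos π) (hu' : u ∉ UNeg π) :
    mKer β β' π u = fibre π u := by
  rw [mKer, if_neg fun hA => hu hA.1, if_neg fun hA => hu' hA.1]

lemma aemeasurable_comp_of_ae_mem {m : Measure ℝ} {q : ℝ → ℝ × ℝ × Measure ℝ × Measure ℝ}
    (hβ : Measurable fun b : exchDomain => β b) (hq : AEMeasurable q m)
    (hmem : ∀ᵐ u ∂m, q u ∈ exchDomain) : AEMeasurable (fun u => β (q u)) m := by
  -- Measurability is known only on 𝔅; the extension by the zero measure outside is almost surely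
  -- never evaluated there.
  obtain ⟨g, hg, hgβ⟩ := (MeasurableEmbedding.subtype_coe
    measurableSet_exchDomain).exists_measurable_extend hβ fun _ => ⟨0⟩
  refine (hg.comp_aemeasurable hq).congr ?_
  filter_upwards [hmem] with u hu
  exact congrFun hgβ ⟨q u, hu⟩

lemma aemeasurable_mKer (h : DispersedCoupling μ ν π) (hβ : IsExchange β β') :
    AEMeasurable (mKer β β' π) lebUnit := by
  have hU : UPos π ∪ (UNeg π ∪ (UPos π ∪ UNeg π)ᶜ) = univ := by
    rw [← union_assoc, union_compl_self]
  rw [← Measure.restrict_univ (μ := lebUnit), ← hU, aemeasurable_union_iff,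
    aemeasurable_union_iff]
  have hq := h.measurable_quant
  have hf := h.measurable_fibre
  refine ⟨?_, ?_, ?_⟩
  · have hφ := h.aemeasurable_phi_UPos
    have h1 : AEMeasurable (quadruple π) (lebUnit.restrict (UPos π)) :=
      hq.aemeasurable.prodMk ((hq.comp_aemeasurable hφ).prodMk
        (hf.aemeasurable.prodMk (hf.comp_aemeasurable hφ)))
    refine (aemeasurable_comp_of_ae_mem hβ.measurable_left h1
      ((ae_restrict_iff' h.measurableSet_UPos).2 h.quadruple_mem_ae)).congr ?_
    filter_upwards [(ae_restrict_iff' h.measurableSet_UPos).2 h.mKer_ae_UPos] with u hu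
    exact hu.symm
  · have hφ := h.aemeasurable_phi_UNeg
    have h1 : AEMeasurable (fun u => quadruple π (phi π u)) (lebUnit.restrict (UNeg π)) := by
      -- Replacing φ(φ(u)) by u removes the composition φ ∘ φ, whose measurability would be a
      -- separate question.
      have h2 : AEMeasurable (fun u => (quant π (phi π u), quant π u, fibre π (phi π u),
          fibre π u)) (lebUnit.restrict (UNeg π)) :=
        (hq.comp_aemeasurable hφ).prodMk (hq.aemeasurable.prodMk
          ((hf.comp_aemeasurable hφ).prodMk hf.aemeasurable))
      refine h2.congr ?_
      filter_upwards [(ae_restrict_iff' h.measurableSet_UNeg).2 h.phi_ae_UNeg] with u hu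
      simp only [quadruple, hu.2.1]
    refine (aemeasurable_comp_of_ae_mem hβ.measurable_right h1
      ((ae_restrict_iff' h.measurableSet_UNeg).2 h.quadruple_phi_mem_ae)).congr ?_
    filter_upwards [(ae_restrict_iff' h.measurableSet_UNeg).2 h.mKer_ae_UNeg] with u hu
    exact hu.symm
  · refine hf.aemeasurable.congr ?_
    filter_upwards [ae_restrict_mem (h.measurableSet_UPos.union h.measurableSet_UNeg).compl]
      with u hu
    exact (mKer_of_notMem (fun h' => hu (Or.inl h')) (fun h' => hu (Or.inr h'))).symm

lemma stochOrder_refl (η : Measure ℝ) : StochOrder η η := fun _ _ => le_rfl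

/-- The properties of the family `(m_u)`: its means, and its position relative to the fibres
of `π` in the stochastic order. -/
lemma mKer_spec_ae (h : DispersedCoupling μ ν π) (hβ : IsExchange β β') :
    ∀ᵐ u ∂lebUnit, mKer β β' π u ∈ P1 ∧ mean (mKer β β' π u) = quant π u ∧
      (bary π u ≤ quant π u → StochOrder (fibre π u) (mKer β β' π u)) ∧
      (quant π u ≤ bary π u → StochOrder (mKer β β' π u) (fibre π u)) := by
  filter_upwards [h.mKer_ae_UPos (β := β) (β' := β'), h.mKer_ae_UNeg (β := β) (β' := β'),
    h.quadruple_mem_ae, h.quadruple_phi_mem_ae, h.phi_ae_UNeg, h.fibre_mem_ae,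
    ae_restrict_mem measurableSet_Ioo] with u h1 h2 h3 h4 h5 h6 h7
  by_cases hp : u ∈ UPos π
  · rw [h1 hp]
    exact ⟨hβ.mem_left _ (h3 hp), hβ.mean_left _ _ _ _ (h3 hp),
      fun _ => hβ.order_left _ _ _ _ (h3 hp), fun hle => absurd hp.2 (not_lt.2 hle)⟩
  by_cases hn : u ∈ UNeg π
  · have h8 := (h5 hn).2.1
    have h9 := hβ.mean_right _ _ _ _ (h4 hn)
    have h10 := hβ.order_right _ _ _ _ (h4 hn)
    rw [h2 hn]
    refine ⟨hβ.mem_right _ (h4 hn), h9.trans (by rw [h8]), fun hle => absurd hn.2 (not_lt.2 hle),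
      fun _ => ?_⟩
    rw [h8] at h10
    simp only [quadruple, h8]
    exact h10
  · have heq : bary π u = quant π u :=
      le_antisymm (not_lt.1 fun hlt => hn ⟨h7, hlt⟩) (not_lt.1 fun hlt => hp ⟨h7, hlt⟩)
    rw [mKer_of_notMem hp hn]
    exact ⟨h6, heq, fun _ => stochOrder_refl _, fun _ => stochOrder_refl _⟩

/-- The exchange maps preserve the total mass put on each set by a pair of exchanged fibres. -/
lemma exchange_mass (hβ : IsExchange β β') {y y' : ℝ} {η η' : Measure ℝ}
    (hb : (y, y', η, η') ∈ exchDomain) (s : Set ℝ) :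
    β (y, y', η, η') s
        + ENNReal.ofReal (y - mean η) * (β' (y, y', η, η') s / ENNReal.ofReal (mean η' - y'))
      = η s + ENNReal.ofReal (y - mean η) * (η' s / ENNReal.ofReal (mean η' - y')) := by
  obtain ⟨h1, h2⟩ : mean η < y ∧ y' < mean η' := ⟨hb.2.2.1, hb.2.2.2.2⟩
  have hd : 0 < y - mean η := sub_pos.2 h1
  have hd' : 0 < mean η' - y' := sub_pos.2 h2
  set p := exchWeight y y' η η' with hp
  have hpe : p = (mean η' - y') / (y - mean η + (mean η' - y')) := by
    rw [hp, exchWeight]; ring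
  have hp1 : 1 - p = (y - mean η) / (y - mean η + (mean η' - y')) := by
    rw [hpe]; field_simp; ring
  have hppos : 0 < p := by rw [hpe]; positivity
  set c := ENNReal.ofReal p⁻¹ with hc
  have hc1 : c * ENNReal.ofReal p = 1 := by
    rw [hc, ← ENNReal.ofReal_mul (by positivity), inv_mul_cancel₀ hppos.ne', ENNReal.ofReal_one]
  have hc2 : c * ENNReal.ofReal (1 - p)
      = ENNReal.ofReal (y - mean η) / ENNReal.ofReal (mean η' - y') := by
    rw [hc, ← ENNReal.ofReal_mul (by positivity), ← ENNReal.ofReal_div_of_pos hd']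
    congr 1
    rw [hp1, hpe]
    field_simp
  have hmix := congrArg (fun m : Measure ℝ => c * m s) (hβ.mixture y y' η η' hb)
  simp only [Measure.coe_add, Measure.coe_smul, Pi.add_apply, Pi.smul_apply, smul_eq_mul,
    mul_add, ← mul_assoc] at hmix
  rw [← hp, hc1, hc2, one_mul, one_mul] at hmix
  simpa only [div_eq_mul_inv, mul_comm, mul_left_comm, mul_assoc] using hmix

lemma excessPos_of_mem {u : ℝ} (hu : u ∈ UPos π) :
    excessPos π u = quant π u - mean (fibre π u) :=
  max_eq_left (sub_nonneg.2 hu.2.le)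

lemma excessNeg_of_mem {u : ℝ} (hu : u ∈ UNeg π) :
    excessNeg π u = mean (fibre π u) - quant π u :=
  max_eq_left (sub_nonneg.2 hu.2.le)

/-- The change of variables moves the integral over 𝒰⁻ onto 𝒰⁺, where the combined integrands agree
pointwise by `exchange_mass`. Taking all u, this is conservation of the second marginal. -/
lemma lintegral_mKer (h : DispersedCoupling μ ν π) (hβ : IsExchange β β') {s : Set ℝ}
    (hs : MeasurableSet s) :
    ∫⁻ u, mKer β β' π u s ∂lebUnit = ∫⁻ u, fibre π u s ∂lebUnit := by
  have hmK : AEMeasurable (fun u => mKer β β' π u s) lebUnit :=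
    (Measure.measurable_coe hs).comp_aemeasurable (h.aemeasurable_mKer hβ)
  have hmf : AEMeasurable (fun u => fibre π u s) lebUnit :=
    ((Measure.measurable_coe hs).comp h.measurable_fibre).aemeasurable
  have hsplit : ∀ H : ℝ → ENNReal, AEMeasurable H lebUnit → ∫⁻ u, H u ∂lebUnit
      = (∫⁻ u in UPos π, (H u + ENNReal.ofReal (excessPos π u) *
          (H (phi π u) / ENNReal.ofReal (excessNeg π (phi π u)))) ∂lebUnit)
        + ∫⁻ u in (UPos π ∪ UNeg π)ᶜ, H u ∂lebUnit := by
    intro H hH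
    rw [lintegral_add_left' hH.restrict, ← h.setLIntegral_UNeg hH,
      ← lintegral_union h.measurableSet_UNeg disjoint_UPos_UNeg,
      lintegral_add_compl _ (h.measurableSet_UPos.union h.measurableSet_UNeg)]
  rw [hsplit _ hmK, hsplit _ hmf]
  congr 1
  · refine setLIntegral_congr_fun_ae h.measurableSet_UPos ?_
    filter_upwards [h.mKer_ae_UPos (β := β) (β' := β'),
      h.comp_phi_ae_UPos (h.mKer_ae_UNeg (β := β) (β' := β')), h.quadruple_mem_ae,
      h.phi_ae_UPos] with u h1 h2 h3 h4 hu
    obtain ⟨h5, h6, -⟩ := h4 hu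
    rw [h1 hu, h2 hu h5, h6, excessPos_of_mem hu, excessNeg_of_mem h5]
    exact exchange_mass hβ (h3 hu) s
  · refine setLIntegral_congr_fun
      (h.measurableSet_UPos.union h.measurableSet_UNeg).compl fun u hu => ?_
    rw [mKer_of_notMem (fun h' => hu (Or.inl h')) (fun h' => hu (Or.inr h'))]

open ProbabilityTheory in
-- The family (m_u) is only almost everywhere measurable and a probability; changing it on a null
-- set to a Dirac mass gives a genuine Markov kernel.
lemma exists_kernel (h : DispersedCoupling μ ν π) (hβ : IsExchange β β') :
    ∃ κ : Kernel ℝ ℝ, IsMarkovKernel κ ∧ (∀ᵐ u ∂lebUnit, mKer β β' π u = κ u) ∧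
      rearrangement β β' π = (lebUnit ⊗ₘ κ).map fun z => (quant π z.1, z.2) := by
  classical
  obtain ⟨g, hg, hgm⟩ := h.aemeasurable_mKer hβ
  have hS : MeasurableSet {u | g u univ = 1} :=
    ((Measure.measurable_coe MeasurableSet.univ).comp hg) (measurableSet_singleton 1)
  let κ : Kernel ℝ ℝ := ⟨fun u => if u ∈ {u | g u univ = 1} then g u else Measure.dirac 0,
    Measurable.ite hS hg measurable_const⟩
  have hκ : ∀ u, κ u = if g u univ = 1 then g u else Measure.dirac 0 := fun u => rfl
  have hM : IsMarkovKernel κ := by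
    refine ⟨fun u => ⟨?_⟩⟩
    rw [hκ]
    split_ifs with hu
    · exact hu
    · exact measure_univ
  have hae : ∀ᵐ u ∂lebUnit, mKer β β' π u = κ u := by
    filter_upwards [hgm, h.mKer_spec_ae hβ] with u h1 h2
    have := h2.1.1
    rw [hκ, ← h1, if_pos measure_univ]
  refine ⟨κ, hM, hae, ?_⟩
  have hq := h.measurable_quant
  have hae' : ∀ᵐ u ∂lebUnit, (Measure.dirac (quant π u)).prod (mKer β β' π u)
      = (Kernel.deterministic (quant π) hq ×ₖ κ) u := by
    filter_upwards [hae] with u hu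
    rw [hu, Kernel.prod_apply, Kernel.deterministic_apply]
  rw [rearrangement, Measure.bind_congr_right hae']
  ext s hs
  have hm : Measurable fun z : ℝ × ℝ => (quant π z.1, z.2) :=
    (hq.comp measurable_fst).prodMk measurable_snd
  rw [Measure.bind_apply hs (Kernel.measurable _).aemeasurable, Measure.map_apply hm hs,
    Measure.compProd_apply (hm hs)]
  refine lintegral_congr fun u => ?_
  rw [Kernel.prod_apply, Kernel.deterministic_apply, Measure.dirac_prod,
    Measure.map_apply measurable_prodMk_left hs]
  rfl

/-! ### Marginals, martingale property and fibres of the rearranged coupling -/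

lemma fst_rearrangement (h : DispersedCoupling μ ν π) (hβ : IsExchange β β') :
    (rearrangement β β' π).fst = μ := by
  obtain ⟨κ, hκ, -, hM⟩ := h.exists_kernel hβ
  have hm : Measurable fun z : ℝ × ℝ => (quant π z.1, z.2) :=
    (h.measurable_quant.comp measurable_fst).prodMk measurable_snd
  rw [hM, Measure.fst, Measure.map_map measurable_fst hm]
  have h1 : lebUnit = (lebUnit.compProd κ).fst := (Measure.fst_compProd _ _).symm
  conv_rhs => rw [← h.map_quant, h1, Measure.fst, Measure.map_map h.measurable_quant
    measurable_fst]
  rfl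

lemma rearrangement_prod (h : DispersedCoupling μ ν π) (hβ : IsExchange β β') {s t : Set ℝ}
    (hs : MeasurableSet s) (ht : MeasurableSet t) :
    rearrangement β β' π (s ×ˢ t) = ∫⁻ u in quant π ⁻¹' s, mKer β β' π u t ∂lebUnit := by
  obtain ⟨κ, hκ, hae, hM⟩ := h.exists_kernel hβ
  have hm : Measurable fun z : ℝ × ℝ => (quant π z.1, z.2) :=
    (h.measurable_quant.comp measurable_fst).prodMk measurable_snd
  have hpre : (fun z : ℝ × ℝ => (quant π z.1, z.2)) ⁻¹' (s ×ˢ t) = (quant π ⁻¹' s) ×ˢ t := rfl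
  rw [hM, Measure.map_apply hm (hs.prod ht), hpre,
    Measure.compProd_apply_prod (h.measurable_quant hs) ht]
  refine lintegral_congr_ae (ae_restrict_of_ae ?_)
  filter_upwards [hae] with u hu
  rw [hu]

lemma setLIntegral_fibre (h : DispersedCoupling μ ν π) {s t : Set ℝ}
    (hs : MeasurableSet s) (ht : MeasurableSet t) :
    ∫⁻ u in quant π ⁻¹' s, fibre π u t ∂lebUnit = ∫⁻ x in s, disint π x t ∂μ := by
  have := h.isProbabilityMeasure
  conv_rhs => rw [← h.map_quant]
  exact (setLIntegral_map hs ((Measure.measurable_coe ht).comp measurable_disint)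
    h.measurable_quant).symm

lemma snd_rearrangement (h : DispersedCoupling μ ν π) (hβ : IsExchange β β') :
    (rearrangement β β' π).snd = ν := by
  have := h.isProbabilityMeasure
  ext s hs
  have h1 := h.rearrangement_prod hβ MeasurableSet.univ hs
  have h2 := h.setLIntegral_fibre MeasurableSet.univ hs
  have h3 := setLIntegral_disint (π := π) MeasurableSet.univ hs
  rw [preimage_univ, Measure.restrict_univ] at h1 h2
  rw [h.mem.1] at h3
  rw [Measure.snd_apply hs, ← univ_prod, h1, h.lintegral_mKer hβ hs, h2, h3, univ_prod,
    ← Measure.snd_apply hs, h.mem.2]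

lemma rearrangement_mem_couplings (h : DispersedCoupling μ ν π) (hβ : IsExchange β β') :
    rearrangement β β' π ∈ couplings μ ν :=
  ⟨h.fst_rearrangement hβ, h.snd_rearrangement hβ⟩

lemma isProbabilityMeasure_rearrangement (h : DispersedCoupling μ ν π) (hβ : IsExchange β β') :
    IsProbabilityMeasure (rearrangement β β' π) :=
  isProbabilityMeasure_of_couplings h.left_mem.1 (h.rearrangement_mem_couplings hβ)

lemma rearrangement_mem_martCouplings (h : DispersedCoupling μ ν π) (hβ : IsExchange β β') :
    rearrangement β β' π ∈ martCouplings μ ν := by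
  refine ⟨h.rearrangement_mem_couplings hβ, ?_⟩
  have := h.isProbabilityMeasure_rearrangement hβ
  have hi := integrable_snd_of_couplings h.right_mem.2 (h.rearrangement_mem_couplings hβ)
  have hfst := h.fst_rearrangement hβ
  have hi2 := integrable_mean_disint hi
  rw [hfst] at hi2
  -- The fibre means of M are identified by integrating over Borel sets s: both sides become the
  -- integral of F_μ⁻¹ over its preimage of s, because m_u has mean F_μ⁻¹(u).
  refine hi2.ae_eq_of_forall_setIntegral_eq _ _ h.left_mem.2 fun s hs _ => ?_
  have h1 := setIntegral_mean_disint hi hs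
  rw [hfst] at h1
  rw [h1]
  obtain ⟨κ, hκ, hae, hM⟩ := h.exists_kernel hβ
  have hm : Measurable fun z : ℝ × ℝ => (quant π z.1, z.2) :=
    (h.measurable_quant.comp measurable_fst).prodMk measurable_snd
  have hpre : (fun z : ℝ × ℝ => (quant π z.1, z.2)) ⁻¹' (s ×ˢ univ)
      = (quant π ⁻¹' s) ×ˢ univ := rfl
  rw [hM] at hi ⊢
  have hi3 : Integrable (fun z : ℝ × ℝ => z.2) (lebUnit.compProd κ) :=
    (integrable_map_measure measurable_snd.aestronglyMeasurable hm.aemeasurable).1 hi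
  rw [setIntegral_map (hs.prod MeasurableSet.univ) measurable_snd.aestronglyMeasurable
    hm.aemeasurable, hpre, Measure.setIntegral_compProd (f := fun z : ℝ × ℝ => z.2)
    (h.measurable_quant hs) MeasurableSet.univ hi3.integrableOn]
  conv_rhs => rw [← h.map_quant]
  rw [setIntegral_map (f := fun x : ℝ => x) hs aestronglyMeasurable_id
    h.measurable_quant.aemeasurable]
  refine integral_congr_ae (ae_restrict_of_ae ?_)
  filter_upwards [hae, h.mKer_spec_ae hβ] with u hu hu'
  rw [Measure.restrict_univ, ← hu]
  exact hu'.2.1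

/-- A comparison of the families `(m_u)` and `(π_{F_μ⁻¹(u)})` passes to the disintegrations. -/
lemma disint_rearrangement_compare (h : DispersedCoupling μ ν π) (hβ : IsExchange β β')
    {S t : Set ℝ} (hS : MeasurableSet S) (ht : MeasurableSet t) :
    ((∀ᵐ u ∂lebUnit, quant π u ∈ S → mKer β β' π u t ≤ fibre π u t) →
      ∀ᵐ x ∂μ, x ∈ S → disint (rearrangement β β' π) x t ≤ disint π x t) ∧
    ((∀ᵐ u ∂lebUnit, quant π u ∈ S → fibre π u t ≤ mKer β β' π u t) →
      ∀ᵐ x ∂μ, x ∈ S → disint π x t ≤ disint (rearrangement β β' π) x t) := by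
  have := h.left_mem.1
  have := h.isProbabilityMeasure
  have := h.isProbabilityMeasure_rearrangement hβ
  have hm := (Measure.measurable_coe ht).comp (measurable_disint (π := π))
  have hm' := (Measure.measurable_coe ht).comp (measurable_disint (π := rearrangement β β' π))
  -- No explicit formula for M_x is needed: both disintegrations, integrated over a test set, become
  -- integrals in u of the compared families.
  have e1 : ∀ A : Set ℝ, MeasurableSet A →
      ∫⁻ x in A, disint (rearrangement β β' π) x t ∂(μ.restrict S)
        = ∫⁻ u in quant π ⁻¹' (A ∩ S), mKer β β' π u t ∂lebUnit := by
    intro A hA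
    have h1 := setLIntegral_disint (π := rearrangement β β' π) (hA.inter hS) ht
    rw [h.fst_rearrangement hβ, h.rearrangement_prod hβ (hA.inter hS) ht] at h1
    rw [Measure.restrict_restrict hA, h1]
  have e2 : ∀ A : Set ℝ, MeasurableSet A → ∫⁻ x in A, disint π x t ∂(μ.restrict S)
        = ∫⁻ u in quant π ⁻¹' (A ∩ S), fibre π u t ∂lebUnit := by
    intro A hA
    rw [Measure.restrict_restrict hA, h.setLIntegral_fibre (hA.inter hS) ht]
  have hpre : ∀ A : Set ℝ, MeasurableSet A → MeasurableSet (quant π ⁻¹' (A ∩ S)) :=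
    fun A hA => h.measurable_quant (hA.inter hS)
  constructor
  · intro hle
    rw [← ae_restrict_iff' hS]
    refine ae_le_of_forall_setLIntegral_le_of_sigmaFinite hm' fun A hA _ => ?_
    refine (e1 A hA).trans_le (le_trans ?_ (e2 A hA).ge)
    refine lintegral_mono_ae ((ae_restrict_iff' (hpre A hA)).2 ?_)
    filter_upwards [hle] with u hu huA
    exact hu huA.2
  · intro hle
    rw [← ae_restrict_iff' hS]
    refine ae_le_of_forall_setLIntegral_le_of_sigmaFinite hm fun A hA _ => ?_
    refine (e2 A hA).trans_le (le_trans ?_ (e1 A hA).ge)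
    refine lintegral_mono_ae ((ae_restrict_iff' (hpre A hA)).2 ?_)
    filter_upwards [hle] with u hu huA
    exact hu huA.2

/-- The direction of the order depends only on the sign of x - m(π_x), hence is common to all u with
F_μ⁻¹(u) = x. -/
lemma stochOrder_disint_ae (h : DispersedCoupling μ ν π) (hβ : IsExchange β β') :
    ∀ᵐ x ∂μ, StochOrder (disint π x) (disint (rearrangement β β' π) x) ∨
      StochOrder (disint (rearrangement β β' π) x) (disint π x) := by
  have := h.isProbabilityMeasure
  have := h.isProbabilityMeasure_rearrangement hβ
  have hS : MeasurableSet {x | mean (disint π x) ≤ x} :=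
    measurableSet_le measurable_mean_disint measurable_id
  have hS' : MeasurableSet {x | x ≤ mean (disint π x)} :=
    measurableSet_le measurable_id measurable_mean_disint
  have h1 : ∀ t : ℚ, ∀ᵐ x ∂μ, x ∈ {x | mean (disint π x) ≤ x} →
      disint (rearrangement β β' π) x (Iic (t : ℝ)) ≤ disint π x (Iic (t : ℝ)) := by
    intro t
    refine (h.disint_rearrangement_compare hβ hS measurableSet_Iic).1 ?_
    filter_upwards [h.mKer_spec_ae hβ] with u hu hmem
    have := hu.1.1
    have := h.isProbabilityMeasure_fibre u
    exact (hu.2.2.1 hmem).measure_Iic_le _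
  have h2 : ∀ t : ℚ, ∀ᵐ x ∂μ, x ∈ {x | x ≤ mean (disint π x)} →
      disint π x (Iic (t : ℝ)) ≤ disint (rearrangement β β' π) x (Iic (t : ℝ)) := by
    intro t
    refine (h.disint_rearrangement_compare hβ hS' measurableSet_Iic).2 ?_
    filter_upwards [h.mKer_spec_ae hβ] with u hu hmem
    have := hu.1.1
    have := h.isProbabilityMeasure_fibre u
    exact (hu.2.2.2 hmem).measure_Iic_le _
  filter_upwards [ae_all_iff.2 h1, ae_all_iff.2 h2] with x hx hx'
  rcases le_total (mean (disint π x)) x with hle | hle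
  · exact Or.inl (stochOrder_of_rat fun t => hx t hle)
  · exact Or.inr (stochOrder_of_rat fun t => hx' t hle)

/-! ### Optimality -/

lemma lintegral_W1_le (h : DispersedCoupling μ ν π) (hβ : IsExchange β β') :
    ∫⁻ x, W1 (disint π x) (disint (rearrangement β β' π) x) ∂μ
      ≤ ∫⁻ x, ENNReal.ofReal |mean (disint π x) - x| ∂μ := by
  have := h.isProbabilityMeasure
  have := h.isProbabilityMeasure_rearrangement hβ
  have h1 := disint_mem_P1_ae h.integrable_snd
  have h2 := disint_mem_P1_ae
    (integrable_snd_of_couplings h.right_mem.2 (h.rearrangement_mem_couplings hβ))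
  rw [h.mem.1] at h1
  rw [h.fst_rearrangement hβ] at h2
  refine lintegral_mono_ae ?_
  filter_upwards [h1, h2, h.stochOrder_disint_ae hβ, (h.rearrangement_mem_martCouplings hβ).2]
    with x hx hx' hord hmean
  have h3 := W1_le_of_stochOrder hx hx' hord
  rwa [hmean] at h3

lemma AW1_le_lintegral_W1 (h : DispersedCoupling μ ν π) {M : Measure (ℝ × ℝ)}
    (hM : M ∈ couplings μ ν) : AW1 π M ≤ ∫⁻ x, W1 (disint π x) (disint M x) ∂μ := by
  have hdiag : Measurable fun x : ℝ => (x, x) := measurable_id.prodMk measurable_id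
  have hmem : μ.map (fun x => (x, x)) ∈ couplings π.fst M.fst := by
    rw [h.mem.1, hM.1]
    constructor
    · rw [Measure.fst, Measure.map_map measurable_fst hdiag]
      exact Measure.map_id
    · rw [Measure.snd, Measure.map_map measurable_snd hdiag]
      exact Measure.map_id
  -- The inequality for a pushed-forward integral requires no measurability of x ↦ W₁(π_x, M_x).
  refine (iInf₂_le _ hmem).trans ((lintegral_map_le _ _).trans_eq ?_)
  simp

lemma le_AW1 (h : DispersedCoupling μ ν π) {M : Measure (ℝ × ℝ)} (hM : M ∈ martCouplings μ ν) :
    ∫⁻ x, ENNReal.ofReal |mean (disint π x) - x| ∂μ ≤ AW1 π M := by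
  have := h.isProbabilityMeasure
  have := isProbabilityMeasure_of_couplings h.left_mem.1 hM.1
  have h1 := disint_mem_P1_ae h.integrable_snd
  have h2 := disint_mem_P1_ae (integrable_snd_of_couplings h.right_mem.2 hM.1)
  have h3 := hM.2
  rw [h.mem.1] at h1
  rw [hM.1.1] at h2
  refine le_iInf₂ fun χ hχ => ?_
  rw [h.mem.1, hM.1.1] at hχ
  have hmeas : Measurable fun x => ENNReal.ofReal |mean (disint π x) - x| :=
    ((measurable_mean_disint.sub measurable_id).abs).ennreal_ofReal
  conv_lhs => rw [← hχ.1, Measure.fst]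
  rw [lintegral_map hmeas measurable_fst]
  rw [← hχ.1] at h1
  rw [← hχ.2] at h2 h3
  refine lintegral_mono_ae ?_
  filter_upwards [ae_of_ae_map measurable_fst.aemeasurable h1,
    ae_of_ae_map measurable_snd.aemeasurable h2, ae_of_ae_map measurable_snd.aemeasurable h3]
    with z hz1 hz2 hz3
  have h4 := ofReal_abs_mean_sub_le_W1 hz1.2 hz2.2
  rw [hz3] at h4
  refine le_trans ?_ (add_le_add_right h4 _)
  rw [← ENNReal.ofReal_add (abs_nonneg _) (abs_nonneg _)]
  refine ENNReal.ofReal_le_ofReal ?_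
  calc |mean (disint π z.1) - z.1| = |(mean (disint π z.1) - z.2) + (z.2 - z.1)| := by ring_nf
    _ ≤ |mean (disint π z.1) - z.2| + |z.2 - z.1| := abs_add_le _ _
    _ = |z.1 - z.2| + |mean (disint π z.1) - z.2| := by rw [abs_sub_comm z.2 z.1, add_comm]

/-- The inequalities close a cycle: ∫|m(π_x) - x| ≤ inf AW₁ ≤ AW₁(π, M) ≤ ∫W₁(π_x, M_x) ≤ ∫|m(π_x) -
x|. -/
theorem rearrangementIdentities (h : DispersedCoupling μ ν π) (hβ : IsExchange β β') :
    RearrangementIdentities μ ν π (rearrangement β β' π) := by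
  have hmart := h.rearrangement_mem_martCouplings hβ
  have h1 := h.AW1_le_lintegral_W1 hmart.1
  have h2 := h.lintegral_W1_le hβ
  have h3 : ∫⁻ x, ENNReal.ofReal |mean (disint π x) - x| ∂μ
      ≤ ⨅ M' ∈ martCouplings μ ν, AW1 π M' := le_iInf₂ fun M' hM' => h.le_AW1 hM'
  have h4 : ⨅ M' ∈ martCouplings μ ν, AW1 π M' ≤ AW1 π (rearrangement β β' π) :=
    iInf₂_le _ hmart
  refine ⟨⟨hmart, le_antisymm ((h1.trans h2).trans h3) h4⟩,
    le_antisymm h1 (h2.trans (h3.trans h4)), le_antisymm h2 ((h3.trans h4).trans h1), ?_⟩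
  have h5 := h.integrable_excess.abs
  refine lt_of_eq_of_lt ?_ h5.lintegral_lt_top
  refine lintegral_congr fun x => ?_
  rw [abs_sub_comm]

end DispersedCoupling

end Rearrangement

/-! ### The explicit exchange of mass -/

section IntervalIntegrals

lemma intervalIntegral_ite {f₁ f₂ : ℝ → ℝ} {r : ℝ} (hr : r ∈ Icc (0 : ℝ) 1)
    (hi : IntervalIntegrable (fun u => if u < r then f₁ u else f₂ u) volume 0 1) :
    ∫ u in (0 : ℝ)..1, (if u < r then f₁ u else f₂ u)
      = (∫ u in (0 : ℝ)..r, f₁ u) + ∫ u in r..1, f₂ u := by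
  have h1 : IntervalIntegrable (fun u => if u < r then f₁ u else f₂ u) volume 0 r :=
    hi.mono_set (by
      rw [uIcc_of_le zero_le_one]
      exact uIcc_subset_Icc ⟨le_rfl, zero_le_one⟩ hr)
  have h2 : IntervalIntegrable (fun u => if u < r then f₁ u else f₂ u) volume r 1 :=
    hi.mono_set (by
      rw [uIcc_of_le zero_le_one]
      exact uIcc_subset_Icc hr ⟨zero_le_one, le_rfl⟩)
  rw [← intervalIntegral.integral_add_adjacent_intervals h1 h2]
  congr 1
  · rw [intervalIntegral.integral_of_le hr.1, intervalIntegral.integral_of_le hr.1,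
      integral_Ioc_eq_integral_Ioo, integral_Ioc_eq_integral_Ioo]
    exact setIntegral_congr_fun measurableSet_Ioo fun u hu => if_pos hu.2
  · rw [intervalIntegral.integral_of_le hr.2, intervalIntegral.integral_of_le hr.2]
    exact setIntegral_congr_fun measurableSet_Ioc fun u hu => if_neg (not_lt.2 hu.1.le)

variable {F : ℝ → ℝ} {a b : ℝ}

lemma intervalIntegral_le_of_monotoneOn (hF : MonotoneOn F (Ioo 0 1))
    (hi : IntegrableOn F (Ioo 0 1)) (ha : 0 ≤ a) (hab : a ≤ b) (hb : b ∈ Ioo (0 : ℝ) 1) :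
    ∫ u in a..b, F u ≤ (b - a) * F b := by
  have h1 := intervalIntegrable_of_unit hi (a := a) (b := b) ⟨ha, hab.trans hb.2.le⟩
    (Ioo_subset_Icc_self hb)
  refine (intervalIntegral.integral_mono_on_of_le_Ioo hab h1
    (intervalIntegrable_const (c := F b)) fun u hu => ?_).trans_eq ?_
  · exact hF ⟨ha.trans_lt hu.1, hu.2.trans hb.2⟩ hb hu.2.le
  · rw [intervalIntegral.integral_const, smul_eq_mul]

lemma le_intervalIntegral_of_monotoneOn (hF : MonotoneOn F (Ioo 0 1))
    (hi : IntegrableOn F (Ioo 0 1)) (ha : a ∈ Ioo (0 : ℝ) 1) (hab : a ≤ b) (hb : b ≤ 1) :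
    (b - a) * F a ≤ ∫ u in a..b, F u := by
  have h1 := intervalIntegrable_of_unit hi (a := a) (b := b) (Ioo_subset_Icc_self ha)
    ⟨ha.1.le.trans hab, hb⟩
  refine le_trans (le_of_eq ?_) (intervalIntegral.integral_mono_on_of_le_Ioo hab
    (intervalIntegrable_const (c := F a)) h1 fun u hu => ?_)
  · rw [intervalIntegral.integral_const, smul_eq_mul]
  · exact hF ha ⟨ha.1.trans hu.1, hu.2.trans_le hb⟩ hu.1.le

lemma integral_eq_primitive_sub (hi : IntegrableOn F (Ioo 0 1)) (ha : a ∈ Icc (0 : ℝ) 1)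
    (hb : b ∈ Icc (0 : ℝ) 1) : ∫ u in a..b, F u = primitive F b - primitive F a := by
  have hz : (0 : ℝ) ∈ Icc (0 : ℝ) 1 := ⟨le_rfl, zero_le_one⟩
  have h := intervalIntegral.integral_add_adjacent_intervals
    (intervalIntegrable_of_unit hi hz ha) (intervalIntegrable_of_unit hi ha hb)
  simp only [primitive]
  linarith

/-- The average of F over (0, a) is at most F(a), which is at most its average over (a, 1). -/
lemma primitive_le_of_monotoneOn (hF : MonotoneOn F (Ioo 0 1)) (hi : IntegrableOn F (Ioo 0 1))
    (ha : a ∈ Icc (0 : ℝ) 1) : primitive F a ≤ a * primitive F 1 := by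
  rcases eq_or_lt_of_le ha.1 with h0 | h0
  · simp [primitive, ← h0]
  rcases eq_or_lt_of_le ha.2 with h1 | h1
  · simp [h1]
  have h2 := intervalIntegral_le_of_monotoneOn hF hi le_rfl h0.le ⟨h0, h1⟩
  have h3 := le_intervalIntegral_of_monotoneOn hF hi ⟨h0, h1⟩ h1.le le_rfl
  rw [integral_eq_primitive_sub hi ha ⟨zero_le_one, le_rfl⟩] at h3
  rw [sub_zero] at h2
  change primitive F a ≤ a * F a at h2
  nlinarith [mul_le_mul_of_nonneg_left h2 (sub_nonneg.2 h1.le),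
    mul_le_mul_of_nonneg_left h3 h0.le]

end IntervalIntegrals

/-! ### Swapping the lowest mass q of η with the highest mass q of η' -/

section Exchange

/-- The image of `η` once its lowest mass `q` is exchanged with the highest mass of `η'`. -/
def exchFunLeft (p q : ℝ) (η η' : Measure ℝ) (u : ℝ) : ℝ :=
  if u < q / p then quantile η' ((1 - p * u - p) / (1 - p)) else quantile η u

/-- The image of `η'` after the same exchange. -/
def exchFunRight (p q : ℝ) (η η' : Measure ℝ) (u : ℝ) : ℝ :=
  if u < q / (1 - p) then quantile η ((1 - p) * u / p) else quantile η' (u - q / (1 - p))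

/-- The law of `exchFunLeft`. -/
def exchLawLeft (p q : ℝ) (η η' : Measure ℝ) : Measure ℝ :=
  (volume.restrict (Icc (0 : ℝ) 1)).map (exchFunLeft p q η η')

/-- The law of `exchFunRight`. -/
def exchLawRight (p q : ℝ) (η η' : Measure ℝ) : Measure ℝ :=
  (volume.restrict (Icc (0 : ℝ) 1)).map (exchFunRight p q η η')

lemma volume_restrict_Icc_eq : volume.restrict (Icc (0 : ℝ) 1) = lebUnit :=
  Measure.restrict_congr_set Ioo_ae_eq_Icc.symm

variable {p q : ℝ} {η η' : Measure ℝ}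

/-- The change of variables behind the exchange of mass. -/
lemma exchange_integral {f g : ℝ → ℝ} (hp : p ∈ Ioo (0 : ℝ) 1)
    (hq : q ∈ Icc 0 (min p (1 - p))) (hf : IntegrableOn f (Ioo 0 1))
    (hg : IntegrableOn g (Ioo 0 1)) :
    p * ((∫ u in (0 : ℝ)..(q / p), g ((1 - p * u - p) / (1 - p))) + ∫ u in (q / p)..1, f u)
        = p * primitive f 1 - p * primitive f (q / p)
          + (1 - p) * (primitive g 1 - primitive g ((1 - q - p) / (1 - p))) ∧
    (1 - p) * ((∫ u in (0 : ℝ)..(q / (1 - p)), f ((1 - p) * u / p))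
        + ∫ u in (0 : ℝ)..((1 - q - p) / (1 - p)), g u)
      = p * primitive f (q / p) + (1 - p) * primitive g ((1 - q - p) / (1 - p)) := by
  have hp0 : 0 < p := hp.1
  have hp1 : 0 < 1 - p := sub_pos.2 hp.2
  have hqp : q ≤ p := hq.2.trans (min_le_left _ _)
  have hqp' : q ≤ 1 - p := hq.2.trans (min_le_right _ _)
  have h1 : q / p ∈ Icc (0 : ℝ) 1 := ⟨div_nonneg hq.1 hp0.le, (div_le_one hp0).2 hqp⟩
  have h2 : (1 - q - p) / (1 - p) ∈ Icc (0 : ℝ) 1 :=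
    ⟨div_nonneg (by linarith) hp1.le, (div_le_one hp1).2 (by linarith [hq.1])⟩
  have h3 : (1 : ℝ) ∈ Icc (0 : ℝ) 1 := ⟨zero_le_one, le_rfl⟩
  have e1 : (∫ u in (0 : ℝ)..(q / p), g ((1 - p * u - p) / (1 - p)))
      = (1 - p) / p * (primitive g 1 - primitive g ((1 - q - p) / (1 - p))) := by
    have hfun : (fun u => g ((1 - p * u - p) / (1 - p))) = fun u => g (1 - p / (1 - p) * u) := by
      ext u
      congr 1
      field_simp
      ring
    rw [hfun, intervalIntegral.integral_comp_sub_mul g (c := p / (1 - p)) (by positivity) 1,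
      ← integral_eq_primitive_sub hg h2 h3, smul_eq_mul]
    congr 1
    · field_simp
    · congr 1
      · field_simp
        ring
      · ring
  have e2 : (∫ u in (0 : ℝ)..(q / (1 - p)), f ((1 - p) * u / p))
      = p / (1 - p) * primitive f (q / p) := by
    have hfun : (fun u => f ((1 - p) * u / p)) = fun u => f ((1 - p) / p * u) := by
      ext u
      congr 1
      ring
    rw [hfun, intervalIntegral.integral_comp_mul_left f (c := (1 - p) / p) (by positivity),
      smul_eq_mul, primitive]
    congr 1
    · field_simp
    · congr 1
      · ring
      · field_simp
  rw [e1, e2, integral_eq_primitive_sub hf h1 h3]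
  constructor
  · field_simp
    ring
  · change (1 - p) * (_ + primitive g ((1 - q - p) / (1 - p))) = _
    field_simp

lemma measurable_exchFunLeft_uncurry {Ω : Type*} [MeasurableSpace Ω] {P Q : Ω → ℝ}
    {κ κ' : Ω → Measure ℝ} (hP : Measurable P) (hQ : Measurable Q) (hκ : Measurable κ)
    (hκ' : Measurable κ') (h : ∀ ω, IsProbabilityMeasure (κ ω))
    (h' : ∀ ω, IsProbabilityMeasure (κ' ω)) :
    Measurable fun z : Ω × ℝ => exchFunLeft (P z.1) (Q z.1) (κ z.1) (κ' z.1) z.2 := by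
  have hP1 : Measurable fun z : Ω × ℝ => P z.1 := hP.comp measurable_fst
  have hQ1 : Measurable fun z : Ω × ℝ => Q z.1 := hQ.comp measurable_fst
  refine Measurable.ite (measurableSet_lt measurable_snd (hQ1.div hP1)) ?_
    (measurable_quantile_uncurry hκ h)
  have h1 : Measurable fun z : Ω × ℝ => (z.1, (1 - P z.1 * z.2 - P z.1) / (1 - P z.1)) :=
    measurable_fst.prodMk ((((measurable_const.sub (hP1.mul measurable_snd)).sub hP1)).div
      (measurable_const.sub hP1))
  exact (measurable_quantile_uncurry hκ' h').comp h1

lemma measurable_exchFunRight_uncurry {Ω : Type*} [MeasurableSpace Ω] {P Q : Ω → ℝ}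
    {κ κ' : Ω → Measure ℝ} (hP : Measurable P) (hQ : Measurable Q) (hκ : Measurable κ)
    (hκ' : Measurable κ') (h : ∀ ω, IsProbabilityMeasure (κ ω))
    (h' : ∀ ω, IsProbabilityMeasure (κ' ω)) :
    Measurable fun z : Ω × ℝ => exchFunRight (P z.1) (Q z.1) (κ z.1) (κ' z.1) z.2 := by
  have hP1 : Measurable fun z : Ω × ℝ => P z.1 := hP.comp measurable_fst
  have hQ1 : Measurable fun z : Ω × ℝ => Q z.1 := hQ.comp measurable_fst
  have hr : Measurable fun z : Ω × ℝ => Q z.1 / (1 - P z.1) :=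
    hQ1.div (measurable_const.sub hP1)
  have h1 : Measurable fun z : Ω × ℝ => (z.1, (1 - P z.1) * z.2 / P z.1) :=
    measurable_fst.prodMk (((measurable_const.sub hP1).mul measurable_snd).div hP1)
  have h2 : Measurable fun z : Ω × ℝ => (z.1, z.2 - Q z.1 / (1 - P z.1)) :=
    measurable_fst.prodMk (measurable_snd.sub hr)
  exact Measurable.ite (measurableSet_lt measurable_snd hr)
    ((measurable_quantile_uncurry hκ h).comp h1) ((measurable_quantile_uncurry hκ' h').comp h2)

lemma measurable_map_of_uncurry {Ω : Type*} [MeasurableSpace Ω] {f : Ω → ℝ → ℝ}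
    (hf : Measurable fun z : Ω × ℝ => f z.1 z.2) (m : Measure ℝ) [SFinite m] :
    Measurable fun ω => m.map (f ω) := by
  refine Measure.measurable_of_measurable_coe _ fun s hs => ?_
  have h1 : ∀ ω, m.map (f ω) s = m (Prod.mk ω ⁻¹' ((fun z : Ω × ℝ => f z.1 z.2) ⁻¹' s)) :=
    fun ω => Measure.map_apply (hf.comp measurable_prodMk_left) hs
  simp only [h1]
  exact measurable_measure_prodMk_left (hf hs)

lemma measurable_exchFunLeft [h : IsProbabilityMeasure η] [h' : IsProbabilityMeasure η'] :
    Measurable (exchFunLeft p q η η') :=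
  (measurable_exchFunLeft_uncurry (Ω := Unit) (P := fun _ => p) (Q := fun _ => q)
    (κ := fun _ => η) (κ' := fun _ => η') measurable_const measurable_const measurable_const
    measurable_const (fun _ => h) fun _ => h').comp
    (measurable_const.prodMk measurable_id : Measurable fun u : ℝ => ((), u))

lemma measurable_exchFunRight [h : IsProbabilityMeasure η] [h' : IsProbabilityMeasure η'] :
    Measurable (exchFunRight p q η η') :=
  (measurable_exchFunRight_uncurry (Ω := Unit) (P := fun _ => p) (Q := fun _ => q)
    (κ := fun _ => η) (κ' := fun _ => η') measurable_const measurable_const measurable_const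
    measurable_const (fun _ => h) fun _ => h').comp
    (measurable_const.prodMk measurable_id : Measurable fun u : ℝ => ((), u))

instance isProbabilityMeasure_exchLawLeft [IsProbabilityMeasure η] [IsProbabilityMeasure η'] :
    IsProbabilityMeasure (exchLawLeft p q η η') := by
  rw [exchLawLeft, volume_restrict_Icc_eq]
  exact Measure.isProbabilityMeasure_map measurable_exchFunLeft.aemeasurable

instance isProbabilityMeasure_exchLawRight [IsProbabilityMeasure η] [IsProbabilityMeasure η'] :
    IsProbabilityMeasure (exchLawRight p q η η') := by
  rw [exchLawRight, volume_restrict_Icc_eq]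
  exact Measure.isProbabilityMeasure_map measurable_exchFunRight.aemeasurable

lemma measureReal_map_lebUnit {f : ℝ → ℝ} (hf : Measurable f) {s : Set ℝ}
    (hs : MeasurableSet s) :
    (lebUnit.map f).real s = ∫ u in (0 : ℝ)..1, s.indicator (fun _ => (1 : ℝ)) (f u) := by
  rw [intervalIntegral.integral_of_le zero_le_one, integral_Ioc_eq_integral_Ioo,
    ← integral_map (φ := f) hf.aemeasurable
      (measurable_const.indicator hs).aestronglyMeasurable,
    integral_indicator_const _ hs, smul_eq_mul, mul_one]

lemma integrableOn_indicator_comp {f : ℝ → ℝ} (hf : Measurable f) {s : Set ℝ}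
    (hs : MeasurableSet s) :
    IntegrableOn (fun u => s.indicator (fun _ => (1 : ℝ)) (f u)) (Ioo 0 1) := by
  refine Integrable.of_bound (C := 1)
    ((measurable_const.indicator hs).comp hf).aestronglyMeasurable
    (Filter.Eventually.of_forall fun u => ?_)
  by_cases hu : f u ∈ s <;> simp [hu]

lemma intervalIntegral_comp_exchFunLeft {φ : ℝ → ℝ} (hp : p ∈ Ioo (0 : ℝ) 1)
    (hq : q ∈ Icc 0 (min p (1 - p)))
    (hi : IntegrableOn (fun u => φ (exchFunLeft p q η η' u)) (Ioo 0 1)) :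
    ∫ u in (0 : ℝ)..1, φ (exchFunLeft p q η η' u)
      = (∫ u in (0 : ℝ)..(q / p), φ (quantile η' ((1 - p * u - p) / (1 - p))))
        + ∫ u in (q / p)..1, φ (quantile η u) := by
  have h1 : q / p ∈ Icc (0 : ℝ) 1 :=
    ⟨div_nonneg hq.1 hp.1.le, (div_le_one hp.1).2 (hq.2.trans (min_le_left _ _))⟩
  have hi' := intervalIntegrable_of_unit hi (a := 0) (b := 1) ⟨le_rfl, zero_le_one⟩
    ⟨zero_le_one, le_rfl⟩
  simp only [exchFunLeft, apply_ite φ] at hi' ⊢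
  exact intervalIntegral_ite h1 hi'

lemma intervalIntegral_comp_exchFunRight {φ : ℝ → ℝ} (hp : p ∈ Ioo (0 : ℝ) 1)
    (hq : q ∈ Icc 0 (min p (1 - p)))
    (hi : IntegrableOn (fun u => φ (exchFunRight p q η η' u)) (Ioo 0 1)) :
    ∫ u in (0 : ℝ)..1, φ (exchFunRight p q η η' u)
      = (∫ u in (0 : ℝ)..(q / (1 - p)), φ (quantile η ((1 - p) * u / p)))
        + ∫ u in (0 : ℝ)..((1 - q - p) / (1 - p)), φ (quantile η' u) := by
  have hp1 : 0 < 1 - p := sub_pos.2 hp.2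
  have h1 : q / (1 - p) ∈ Icc (0 : ℝ) 1 :=
    ⟨div_nonneg hq.1 hp1.le, (div_le_one hp1).2 (hq.2.trans (min_le_right _ _))⟩
  have hi' := intervalIntegrable_of_unit hi (a := 0) (b := 1) ⟨le_rfl, zero_le_one⟩
    ⟨zero_le_one, le_rfl⟩
  simp only [exchFunRight, apply_ite φ] at hi' ⊢
  rw [intervalIntegral_ite h1 hi',
    intervalIntegral.integral_comp_sub_right (fun u => φ (quantile η' u)), sub_self]
  congr 2
  field_simp
  ring

/-- The exchange keeps the mixture. -/
lemma exchLaw_mixture [IsProbabilityMeasure η] [IsProbabilityMeasure η']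
    (hp : p ∈ Ioo (0 : ℝ) 1) (hq : q ∈ Icc 0 (min p (1 - p))) :
    ENNReal.ofReal p • exchLawLeft p q η η' + ENNReal.ofReal (1 - p) • exchLawRight p q η η'
      = ENNReal.ofReal p • η + ENNReal.ofReal (1 - p) • η' := by
  have hp1 : 0 < 1 - p := sub_pos.2 hp.2
  ext s hs
  have hη := measureReal_map_lebUnit (measurable_quantile η) hs
  have hη' := measureReal_map_lebUnit (measurable_quantile η') hs
  have hL := measureReal_map_lebUnit (measurable_exchFunLeft (p := p) (q := q) (η := η)
    (η' := η')) hs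
  have hR := measureReal_map_lebUnit (measurable_exchFunRight (p := p) (q := q) (η := η)
    (η' := η')) hs
  rw [map_quantile] at hη hη'
  rw [← volume_restrict_Icc_eq] at hL hR
  rw [intervalIntegral_comp_exchFunLeft hp hq
    (integrableOn_indicator_comp measurable_exchFunLeft hs)] at hL
  rw [intervalIntegral_comp_exchFunRight hp hq
    (integrableOn_indicator_comp measurable_exchFunRight hs)] at hR
  -- Applied to the indicator of s along the two quantile functions; the primitives cancel in the
  -- weighted sum.
  have hex := exchange_integral hp hq (integrableOn_indicator_comp (measurable_quantile η) hs)
    (integrableOn_indicator_comp (measurable_quantile η') hs)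
  rw [← hL, ← hR] at hex
  have hreal : p * (exchLawLeft p q η η').real s + (1 - p) * (exchLawRight p q η η').real s
      = p * η.real s + (1 - p) * η'.real s := by
    rw [hη, hη', exchLawLeft, exchLawRight, hex.1, hex.2]
    ring
  have hcast : ∀ (m m' : Measure ℝ) [IsProbabilityMeasure m] [IsProbabilityMeasure m'],
      ENNReal.ofReal p * m s + ENNReal.ofReal (1 - p) * m' s
        = ENNReal.ofReal (p * m.real s + (1 - p) * m'.real s) := by
    intro m m' _ _
    rw [ENNReal.ofReal_add (mul_nonneg hp.1.le measureReal_nonneg)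
      (mul_nonneg hp1.le measureReal_nonneg), ENNReal.ofReal_mul hp.1.le,
      ENNReal.ofReal_mul hp1.le, ofReal_measureReal, ofReal_measureReal]
  simp only [Measure.coe_add, Measure.coe_smul, Pi.add_apply, Pi.smul_apply, smul_eq_mul]
  rw [hcast, hcast, hreal]

lemma exchLaw_mem_P1 (hη : η ∈ P1) (hη' : η' ∈ P1) (hp : p ∈ Ioo (0 : ℝ) 1)
    (hq : q ∈ Icc 0 (min p (1 - p))) :
    exchLawLeft p q η η' ∈ P1 ∧ exchLawRight p q η η' ∈ P1 := by
  have := hη.1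
  have := hη'.1
  have hp1 : 0 < 1 - p := sub_pos.2 hp.2
  have h1 : Integrable (fun x : ℝ => x)
      (ENNReal.ofReal p • η + ENNReal.ofReal (1 - p) • η') :=
    (hη.2.smul_measure ENNReal.ofReal_ne_top).add_measure
      (hη'.2.smul_measure ENNReal.ofReal_ne_top)
  rw [← exchLaw_mixture hp hq] at h1
  exact ⟨⟨inferInstance, (integrable_smul_measure (ENNReal.ofReal_pos.2 hp.1).ne'
      ENNReal.ofReal_ne_top).1 h1.left_of_add_measure⟩,
    ⟨inferInstance, (integrable_smul_measure (ENNReal.ofReal_pos.2 hp1).ne'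
      ENNReal.ofReal_ne_top).1 h1.right_of_add_measure⟩⟩

lemma mean_exchLawLeft (hη : η ∈ P1) (hη' : η' ∈ P1) (hp : p ∈ Ioo (0 : ℝ) 1)
    (hq : q ∈ Icc 0 (min p (1 - p))) : mean (exchLawLeft p q η η') = exchJ p η η' q := by
  have := hη.1
  have := hη'.1
  have h1 := (exchLaw_mem_P1 hη hη' hp hq).1.2
  rw [exchLawLeft, volume_restrict_Icc_eq] at h1
  have h2 : IntegrableOn (exchFunLeft p q η η') (Ioo 0 1) :=
    h1.comp_measurable measurable_exchFunLeft
  rw [mean, exchLawLeft, volume_restrict_Icc_eq, integral_map (f := fun x : ℝ => x)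
    measurable_exchFunLeft.aemeasurable aestronglyMeasurable_id, ← integral_Ioc_eq_integral_Ioo,
    ← intervalIntegral.integral_of_le zero_le_one,
    intervalIntegral_comp_exchFunLeft (φ := fun x => x) hp hq h2]
  rfl

lemma primitive_quantile_one [IsProbabilityMeasure η] : primitive (quantile η) 1 = mean η :=
  mean_eq_intervalIntegral_quantile.symm

/-- The barycentre after the exchange, through the primitives of the quantile functions. -/
lemma mul_exchJ (hη : η ∈ P1) (hη' : η' ∈ P1) (hp : p ∈ Ioo (0 : ℝ) 1)
    (hq : q ∈ Icc 0 (min p (1 - p))) :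
    p * exchJ p η η' q = p * mean η - p * primitive (quantile η) (q / p)
      + (1 - p) * (mean η' - primitive (quantile η') ((1 - q - p) / (1 - p))) := by
  have := hη.1
  have := hη'.1
  have h := (exchange_integral hp hq (integrableOn_quantile hη) (integrableOn_quantile hη')).1
  rw [primitive_quantile_one, primitive_quantile_one] at h
  exact h

/-- The weighted total mean is conserved, so J and J' determine each other. -/
lemma mul_exchJ_add (hη : η ∈ P1) (hη' : η' ∈ P1) (hp : p ∈ Ioo (0 : ℝ) 1)
    (hq : q ∈ Icc 0 (min p (1 - p))) :
    p * exchJ p η η' q + (1 - p) * exchJ' p η η' q = p * mean η + (1 - p) * mean η' := by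
  have h1 := mul_exchJ hη hη' hp hq
  have h2 : (1 - p) * exchJ' p η η' q = _ :=
    (exchange_integral hp hq (integrableOn_quantile hη) (integrableOn_quantile hη')).2
  rw [h1, h2]
  ring

lemma div_mem_Icc (hp : p ∈ Ioo (0 : ℝ) 1) (hq : q ∈ Icc 0 (min p (1 - p))) :
    q / p ∈ Icc (0 : ℝ) 1 ∧ (1 - q - p) / (1 - p) ∈ Icc (0 : ℝ) 1 := by
  have hp1 : 0 < 1 - p := sub_pos.2 hp.2
  have hqp : q ≤ p := hq.2.trans (min_le_left _ _)
  have hqp' : q ≤ 1 - p := hq.2.trans (min_le_right _ _)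
  exact ⟨⟨div_nonneg hq.1 hp.1.le, (div_le_one hp.1).2 hqp⟩,
    ⟨div_nonneg (by linarith) hp1.le, (div_le_one hp1).2 (by linarith [hq.1])⟩⟩

lemma div_mem_Ioo (hp : p ∈ Ioo (0 : ℝ) 1) (hq : q ∈ Ioo 0 (min p (1 - p))) :
    q / p ∈ Ioo (0 : ℝ) 1 ∧ (1 - q - p) / (1 - p) ∈ Ioo (0 : ℝ) 1 := by
  have hp1 : 0 < 1 - p := sub_pos.2 hp.2
  have hqp : q < p := hq.2.trans_le (min_le_left _ _)
  have hqp' : q < 1 - p := hq.2.trans_le (min_le_right _ _)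
  exact ⟨⟨div_pos hq.1 hp.1, (div_lt_one hp.1).2 hqp⟩,
    ⟨div_pos (by linarith) hp1, (div_lt_one hp1).2 (by linarith [hq.1])⟩⟩

lemma continuousOn_exchJ (hη : η ∈ P1) (hη' : η' ∈ P1) (hp : p ∈ Ioo (0 : ℝ) 1) :
    ContinuousOn (exchJ p η η') (Icc 0 (min p (1 - p))) := by
  have h1 : ContinuousOn (fun q => primitive (quantile η) (q / p)) (Icc 0 (min p (1 - p))) :=
    (continuousOn_primitive (integrableOn_quantile hη)).comp (by fun_prop)
      fun q hq => (div_mem_Icc hp hq).1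
  have h2 : ContinuousOn (fun q => primitive (quantile η') ((1 - q - p) / (1 - p)))
      (Icc 0 (min p (1 - p))) :=
    (continuousOn_primitive (integrableOn_quantile hη')).comp (by fun_prop)
      fun q hq => (div_mem_Icc hp hq).2
  have h3 : ContinuousOn (fun q => (p * mean η - p * primitive (quantile η) (q / p)
      + (1 - p) * (mean η' - primitive (quantile η') ((1 - q - p) / (1 - p)))) / p)
      (Icc 0 (min p (1 - p))) :=
    (((continuousOn_const.sub (continuousOn_const.mul h1)).add
      (continuousOn_const.mul (continuousOn_const.sub h2))).div_const p)
  refine h3.congr fun q hq => ?_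
  exact (eq_div_iff hp.1.ne').2 (by rw [mul_comm, mul_exchJ hη hη' hp hq])

/-- The rate of change of the barycentre in the exchanged mass. -/
def exchRate (p : ℝ) (η η' : Measure ℝ) (q : ℝ) : ℝ :=
  quantile η' ((1 - q - p) / (1 - p)) - quantile η (q / p)

lemma mul_exchJ_sub (hη : η ∈ P1) (hη' : η' ∈ P1) (hp : p ∈ Ioo (0 : ℝ) 1) {s t : ℝ}
    (hs : 0 ≤ s) (hst : s ≤ t) (ht : t ≤ min p (1 - p)) :
    p * (exchJ p η η' t - exchJ p η η' s)
      = (1 - p) * (∫ u in ((1 - t - p) / (1 - p))..((1 - s - p) / (1 - p)), quantile η' u)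
        - p * ∫ u in (s / p)..(t / p), quantile η u := by
  have hsI : s ∈ Icc 0 (min p (1 - p)) := ⟨hs, hst.trans ht⟩
  have htI : t ∈ Icc 0 (min p (1 - p)) := ⟨hs.trans hst, ht⟩
  rw [integral_eq_primitive_sub (integrableOn_quantile hη) (div_mem_Icc hp hsI).1
    (div_mem_Icc hp htI).1, integral_eq_primitive_sub (integrableOn_quantile hη')
    (div_mem_Icc hp htI).2 (div_mem_Icc hp hsI).2, mul_sub, mul_exchJ hη hη' hp hsI,
    mul_exchJ hη hη' hp htI]
  ring

/-- Concavity of J: its rate of change is nonincreasing in q, so an increment is at most the rate at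
the left end times the length. `le_exchJ_sub` is the counterpart at the right end. -/
lemma exchJ_sub_le (hη : η ∈ P1) (hη' : η' ∈ P1) (hp : p ∈ Ioo (0 : ℝ) 1) {s t : ℝ}
    (hs : s ∈ Ioo 0 (min p (1 - p))) (hst : s ≤ t) (ht : t ≤ min p (1 - p)) :
    p * (exchJ p η η' t - exchJ p η η' s) ≤ (t - s) * exchRate p η η' s := by
  have := hη.1
  have := hη'.1
  have hp0 : 0 < p := hp.1
  have hp1 : 0 < 1 - p := sub_pos.2 hp.2
  have htI : t ∈ Icc 0 (min p (1 - p)) := ⟨hs.1.le.trans hst, ht⟩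
  rw [mul_exchJ_sub hη hη' hp hs.1.le hst ht]
  have h1 := intervalIntegral_le_of_monotoneOn (monotoneOn_quantile η') (integrableOn_quantile hη')
    (div_mem_Icc hp htI).2.1 (b := (1 - s - p) / (1 - p)) (by gcongr) (div_mem_Ioo hp hs).2
  have h2 := le_intervalIntegral_of_monotoneOn (monotoneOn_quantile η) (integrableOn_quantile hη)
    (div_mem_Ioo hp hs).1 (b := t / p) (by gcongr) (div_mem_Icc hp htI).1.2
  have e1 : (1 - p) * ((1 - s - p) / (1 - p) - (1 - t - p) / (1 - p)) = t - s := by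
    field_simp; ring
  have e2 : p * (t / p - s / p) = t - s := by field_simp
  have h3 := mul_le_mul_of_nonneg_left h1 hp1.le
  have h4 := mul_le_mul_of_nonneg_left h2 hp0.le
  rw [← mul_assoc, e1] at h3
  rw [← mul_assoc, e2] at h4
  rw [exchRate, mul_sub]
  linarith

lemma le_exchJ_sub (hη : η ∈ P1) (hη' : η' ∈ P1) (hp : p ∈ Ioo (0 : ℝ) 1) {s t : ℝ}
    (hs : 0 ≤ s) (hst : s ≤ t) (ht : t ∈ Ioo 0 (min p (1 - p))) :
    (t - s) * exchRate p η η' t ≤ p * (exchJ p η η' t - exchJ p η η' s) := by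
  have := hη.1
  have := hη'.1
  have hp0 : 0 < p := hp.1
  have hp1 : 0 < 1 - p := sub_pos.2 hp.2
  have hsI : s ∈ Icc 0 (min p (1 - p)) := ⟨hs, hst.trans ht.2.le⟩
  rw [mul_exchJ_sub hη hη' hp hs hst ht.2.le]
  have h1 := le_intervalIntegral_of_monotoneOn (monotoneOn_quantile η') (integrableOn_quantile hη')
    (div_mem_Ioo hp ht).2 (b := (1 - s - p) / (1 - p)) (by gcongr) (div_mem_Icc hp hsI).2.2
  have h2 := intervalIntegral_le_of_monotoneOn (monotoneOn_quantile η) (integrableOn_quantile hη)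
    (div_mem_Icc hp hsI).1.1 (b := t / p) (by gcongr) (div_mem_Ioo hp ht).1
  have e1 : (1 - p) * ((1 - s - p) / (1 - p) - (1 - t - p) / (1 - p)) = t - s := by
    field_simp; ring
  have e2 : p * (t / p - s / p) = t - s := by field_simp
  have h3 := mul_le_mul_of_nonneg_left h1 hp1.le
  have h4 := mul_le_mul_of_nonneg_left h2 hp0.le
  rw [← mul_assoc, e1] at h3
  rw [← mul_assoc, e2] at h4
  rw [exchRate, mul_sub]
  linarith

/-! ### The exchanged mass -/

variable {y y' : ℝ}

lemma exchWeight_mem (hb : (y, y', η, η') ∈ exchDomain) :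
    exchWeight y y' η η' ∈ Ioo (0 : ℝ) 1 := by
  obtain ⟨h1, h2⟩ : mean η < y ∧ y' < mean η' := ⟨hb.2.2.1, hb.2.2.2.2⟩
  have hd : 0 < y - mean η + mean η' - y' := by linarith
  exact ⟨div_pos (by linarith) hd, (div_lt_one hd).2 (by linarith)⟩

lemma exchWeight_mul (hb : (y, y', η, η') ∈ exchDomain) :
    exchWeight y y' η η' * (y - mean η) = (1 - exchWeight y y' η η') * (mean η' - y') := by
  obtain ⟨h1, h2⟩ : mean η < y ∧ y' < mean η' := ⟨hb.2.2.1, hb.2.2.2.2⟩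
  have hd : y - mean η + mean η' - y' ≠ 0 := by
    have : 0 < y - mean η + mean η' - y' := by linarith
    exact this.ne'
  rw [exchWeight]
  field_simp
  ring

/-- If p ≤ 1/2, all of η is replaced by the top of η', whose mean is at least m(η') > y' ≥ y. If p ≥
1/2, all of η' is replaced by the bottom of η, whose mean is at most m(η) < y ≤ y', and the
conserved total forces J ≥ y. -/
lemma le_exchJ_min (hb : (y, y', η, η') ∈ exchDomain) :
    y ≤ exchJ (exchWeight y y' η η') η η'
      (min (exchWeight y y' η η') (1 - exchWeight y y' η η')) := by
  have hη : η ∈ P1 := hb.1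
  have hη' : η' ∈ P1 := hb.2.1
  have := hη.1
  have := hη'.1
  obtain ⟨h1, h2, h3⟩ : mean η < y ∧ y ≤ y' ∧ y' < mean η' := hb.2.2
  have hp := exchWeight_mem hb
  have hmul := exchWeight_mul hb
  set p := exchWeight y y' η η'
  have hp0 : 0 < p := hp.1
  have hp1 : 0 < 1 - p := sub_pos.2 hp.2
  have hmin : min p (1 - p) ∈ Icc 0 (min p (1 - p)) := ⟨le_min hp0.le hp1.le, le_rfl⟩
  have hJ := mul_exchJ hη hη' hp hmin
  have hI := div_mem_Icc hp hmin
  have hA := primitive_le_of_monotoneOn (monotoneOn_quantile η) (integrableOn_quantile hη) hI.1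
  have hC := primitive_le_of_monotoneOn (monotoneOn_quantile η') (integrableOn_quantile hη') hI.2
  rw [primitive_quantile_one] at hA hC
  have hA' := mul_le_mul_of_nonneg_left hA hp0.le
  have hC' := mul_le_mul_of_nonneg_left hC hp1.le
  refine le_of_mul_le_mul_left ?_ hp0
  rw [hJ]
  generalize hm : min p (1 - p) = m at *
  have eA : p * (m / p * mean η) = m * mean η := by field_simp
  have eC : (1 - p) * ((1 - m - p) / (1 - p) * mean η') = (1 - m - p) * mean η' := by field_simp
  rw [eA] at hA'
  rw [eC] at hC'
  rcases le_total p (1 - p) with hle | hle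
  · rw [min_eq_left hle] at hm
    subst hm
    nlinarith
  · rw [min_eq_right hle] at hm
    subst hm
    nlinarith

/-- The total mean is p y + (1 - p) y', so J(q) = y and J'(q) = y' are the same equation and the
case distinction disappears. -/
lemma exchMass_eq (hb : (y, y', η, η') ∈ exchDomain) :
    exchMass y y' η η' = sInf {q | q ∈ Icc 0 (min (exchWeight y y' η η')
      (1 - exchWeight y y' η η')) ∧ exchJ (exchWeight y y' η η') η η' q = y} := by
  have hp := exchWeight_mem hb
  have hmul := exchWeight_mul hb
  rw [exchMass]
  set p := exchWeight y y' η η' with hpdef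
  have hp0 : 0 < p := hp.1
  have hp1 : 0 < 1 - p := sub_pos.2 hp.2
  split_ifs with hle
  · rfl
  · congr 1
    ext q
    refine and_congr_right fun hq => ?_
    have h := mul_exchJ_add hb.1 hb.2.1 hp hq
    constructor
    · intro h'
      rw [h'] at h
      exact mul_left_cancel₀ hp0.ne' (by linarith)
    · intro h'
      rw [h'] at h
      exact mul_left_cancel₀ hp1.ne' (by linarith)

lemma exchJ_zero [IsProbabilityMeasure η] : exchJ p η η' 0 = mean η := by
  rw [exchJ, zero_div, intervalIntegral.integral_same, zero_add,
    ← mean_eq_intervalIntegral_quantile]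

lemma exchMass_le_of_le (hb : (y, y', η, η') ∈ exchDomain)
    (hq : q ∈ Icc 0 (min (exchWeight y y' η η') (1 - exchWeight y y' η η')))
    (hy : y ≤ exchJ (exchWeight y y' η η') η η' q) : exchMass y y' η η' ≤ q := by
  have hp := exchWeight_mem hb
  have hc := (continuousOn_exchJ hb.1 hb.2.1 hp).mono (Icc_subset_Icc_right hq.2)
  have := hb.1.1
  have h0 : exchJ (exchWeight y y' η η') η η' 0 = mean η := exchJ_zero
  have hlt : mean η < y := hb.2.2.1
  obtain ⟨r, hr, hrJ⟩ := intermediate_value_Icc hq.1 hc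
    (mem_Icc.2 ⟨(h0.trans_lt hlt).le, hy⟩)
  rw [exchMass_eq hb]
  refine le_trans (csInf_le ⟨0, fun s hs => hs.1.1⟩ ?_) hr.2
  exact ⟨⟨hr.1, hr.2.trans hq.2⟩, hrJ⟩

lemma exchMass_spec (hb : (y, y', η, η') ∈ exchDomain) :
    exchMass y y' η η' ∈ Icc 0 (min (exchWeight y y' η η') (1 - exchWeight y y' η η')) ∧
      exchJ (exchWeight y y' η η') η η' (exchMass y y' η η') = y := by
  have hp := exchWeight_mem hb
  have hc := continuousOn_exchJ hb.1 hb.2.1 hp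
  have := hb.1.1
  have h0 : exchJ (exchWeight y y' η η') η η' 0 = mean η := exchJ_zero
  have hlt : mean η < y := hb.2.2.1
  have hmin : 0 ≤ min (exchWeight y y' η η') (1 - exchWeight y y' η η') :=
    le_min hp.1.le (sub_pos.2 hp.2).le
  obtain ⟨r, hr, hrJ⟩ := intermediate_value_Icc hmin hc
    ⟨(h0.trans_lt hlt).le, le_exchJ_min hb⟩
  have hcl := hc.preimage_isClosed_of_isClosed isClosed_Icc (isClosed_singleton (x := y))
  rw [exchMass_eq hb]
  exact hcl.csInf_mem ⟨r, hr, hrJ⟩ ⟨0, fun s hs => hs.1.1⟩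

/-- Once J has reached y it stays above y, by concavity and the end value. This describes the
sublevel sets of q⋆ by an inequality on J, which yields its measurability. -/
lemma exchMass_le_iff (hb : (y, y', η, η') ∈ exchDomain)
    (hq : q ∈ Icc 0 (min (exchWeight y y' η η') (1 - exchWeight y y' η η'))) :
    exchMass y y' η η' ≤ q ↔ y ≤ exchJ (exchWeight y y' η η') η η' q := by
  refine ⟨fun hle => ?_, exchMass_le_of_le hb hq⟩
  have hp := exchWeight_mem hb
  obtain ⟨hm, hJ⟩ := exchMass_spec hb
  have hend := le_exchJ_min hb
  by_contra hlt
  rw [not_le] at hlt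
  have hne : exchMass y y' η η' ≠ q := fun h => by rw [h] at hJ; exact hlt.ne hJ
  have hqe : q ≠ min (exchWeight y y' η η') (1 - exchWeight y y' η η') := fun h => by
    rw [← h] at hend; exact absurd hend (not_le.2 hlt)
  have hqI : q ∈ Ioo 0 (min (exchWeight y y' η η') (1 - exchWeight y y' η η')) :=
    ⟨hm.1.trans_lt (lt_of_le_of_ne hle hne), lt_of_le_of_ne hq.2 hqe⟩
  have h1 := exchJ_sub_le hb.1 hb.2.1 hp hqI hq.2 le_rfl
  have h2 := le_exchJ_sub hb.1 hb.2.1 hp hm.1 hle hqI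
  rw [hJ] at h2
  -- A fall of J from y to below y between q⋆ and q forces a negative rate at q; J would then stay
  -- below y up to the end.
  have h3 : exchRate (exchWeight y y' η η') η η' q < 0 := by
    by_contra hge
    have h4 := mul_nonneg (sub_nonneg.2 hle) (not_lt.1 hge)
    nlinarith [mul_pos hp.1 (sub_pos.2 hlt)]
  have h4 := mul_nonpos_of_nonneg_of_nonpos (sub_nonneg.2 hq.2) h3.le
  nlinarith [mul_pos hp.1 (sub_pos.2 (hlt.trans_le hend))]

/-- Minimality of q⋆ gives J(s) < y = J(q⋆), and the tangent bound at s leaves no room for a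
negative rate. -/
lemma exchRate_nonneg (hb : (y, y', η, η') ∈ exchDomain) {s : ℝ} (hs : 0 < s)
    (hsm : s < exchMass y y' η η') : 0 ≤ exchRate (exchWeight y y' η η') η η' s := by
  have hp := exchWeight_mem hb
  obtain ⟨hm, hJ⟩ := exchMass_spec hb
  have hsI : s ∈ Ioo 0 (min (exchWeight y y' η η') (1 - exchWeight y y' η η')) :=
    ⟨hs, hsm.trans_le hm.2⟩
  have h1 : exchJ (exchWeight y y' η η') η η' s < y := not_le.1 fun hle =>
    absurd (exchMass_le_of_le hb (Ioo_subset_Icc_self hsI) hle) (not_le.2 hsm)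
  have h2 := exchJ_sub_le hb.1 hb.2.1 hp hsI hsm.le hm.2
  rw [hJ] at h2
  by_contra hlt
  have h3 := mul_nonpos_of_nonneg_of_nonpos (sub_nonneg.2 hsm.le) (not_le.1 hlt).le
  nlinarith [mul_pos hp.1 (sub_pos.2 h1)]

/-! ### Measurable dependence of the exchange on the quadruple -/

lemma measurable_exchWeight_subtype : Measurable fun b : exchDomain =>
    exchWeight b.1.1 b.1.2.1 b.1.2.2.1 b.1.2.2.2 := by
  have h1 : Measurable fun b : exchDomain => b.1.1 := measurable_fst.comp measurable_subtype_coe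
  have h2 : Measurable fun b : exchDomain => b.1.2.1 :=
    (measurable_fst.comp measurable_snd).comp measurable_subtype_coe
  have h3 : Measurable fun b : exchDomain => mean b.1.2.2.1 := measurable_mean.comp
    ((measurable_fst.comp (measurable_snd.comp measurable_snd)).comp measurable_subtype_coe)
  have h4 : Measurable fun b : exchDomain => mean b.1.2.2.2 := measurable_mean.comp
    ((measurable_snd.comp (measurable_snd.comp measurable_snd)).comp measurable_subtype_coe)
  exact (h4.sub h2).div (((h1.sub h3).add h4).sub h2)

lemma measurable_exchLawLeft {Q : exchDomain → ℝ} (hQ : Measurable Q) :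
    Measurable fun b : exchDomain => exchLawLeft (exchWeight b.1.1 b.1.2.1 b.1.2.2.1 b.1.2.2.2)
      (Q b) b.1.2.2.1 b.1.2.2.2 :=
  measurable_map_of_uncurry (measurable_exchFunLeft_uncurry measurable_exchWeight_subtype hQ
    ((measurable_fst.comp (measurable_snd.comp measurable_snd)).comp measurable_subtype_coe)
    ((measurable_snd.comp (measurable_snd.comp measurable_snd)).comp measurable_subtype_coe)
    (fun b => b.2.1.1) fun b => b.2.2.1.1) _

lemma measurable_exchLawRight {Q : exchDomain → ℝ} (hQ : Measurable Q) :
    Measurable fun b : exchDomain => exchLawRight (exchWeight b.1.1 b.1.2.1 b.1.2.2.1 b.1.2.2.2)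
      (Q b) b.1.2.2.1 b.1.2.2.2 :=
  measurable_map_of_uncurry (measurable_exchFunRight_uncurry measurable_exchWeight_subtype hQ
    ((measurable_fst.comp (measurable_snd.comp measurable_snd)).comp measurable_subtype_coe)
    ((measurable_snd.comp (measurable_snd.comp measurable_snd)).comp measurable_subtype_coe)
    (fun b => b.2.1.1) fun b => b.2.2.1.1) _

lemma measurable_exchMass_subtype : Measurable fun b : exchDomain =>
    exchMass b.1.1 b.1.2.1 b.1.2.2.1 b.1.2.2.2 := by
  refine measurable_of_Iic fun r => ?_
  rcases lt_or_ge r 0 with hr | hr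
  · convert MeasurableSet.empty
    refine eq_empty_of_forall_notMem fun b hb => ?_
    exact absurd ((exchMass_spec b.2).1.1.trans hb) (not_le.2 hr)
  · have hP := measurable_exchWeight_subtype
    -- Levels r above p ∧ (1 - p) are truncated, since J is controlled only up to that value.
    have hQ : Measurable fun b : exchDomain =>
        min r (min (exchWeight b.1.1 b.1.2.1 b.1.2.2.1 b.1.2.2.2)
          (1 - exchWeight b.1.1 b.1.2.1 b.1.2.2.1 b.1.2.2.2)) :=
      measurable_const.min (hP.min (measurable_const.sub hP))
    have h1 : Measurable fun b : exchDomain => b.1.1 :=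
      measurable_fst.comp measurable_subtype_coe
    convert measurableSet_le h1 (measurable_mean.comp (measurable_exchLawLeft hQ)) using 1
    ext b
    have hp := exchWeight_mem b.2
    have hq : min r (min (exchWeight b.1.1 b.1.2.1 b.1.2.2.1 b.1.2.2.2)
          (1 - exchWeight b.1.1 b.1.2.1 b.1.2.2.1 b.1.2.2.2))
        ∈ Icc 0 (min (exchWeight b.1.1 b.1.2.1 b.1.2.2.1 b.1.2.2.2)
          (1 - exchWeight b.1.1 b.1.2.1 b.1.2.2.1 b.1.2.2.2)) :=
      ⟨le_min hr (le_min hp.1.le (sub_pos.2 hp.2).le), min_le_right _ _⟩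
    have h2 := exchMass_le_iff b.2 hq
    rw [← mean_exchLawLeft b.2.1 b.2.2.1 hp hq, le_min_iff,
      and_iff_left (exchMass_spec b.2).1.2] at h2
    exact h2

/-! ### Stochastic order and the exchange pair -/

lemma stochOrder_exchLawLeft (hb : (y, y', η, η') ∈ exchDomain) :
    StochOrder η (exchLawLeft (exchWeight y y' η η') (exchMass y y' η η') η η') := by
  have := hb.1.1
  have := hb.2.1.1
  have hp := exchWeight_mem hb
  refine stochOrder_of_rat fun t => ?_
  conv_rhs => rw [← map_quantile η]
  rw [exchLawLeft, volume_restrict_Icc_eq, Measure.map_apply measurable_exchFunLeft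
    measurableSet_Iic, Measure.map_apply (measurable_quantile η) measurableSet_Iic]
  refine measure_mono_ae ?_
  filter_upwards [ae_restrict_mem measurableSet_Ioo] with u hu hut
  refine le_trans ?_ (show exchFunLeft _ _ η η' u ≤ t from hut)
  rw [exchFunLeft]
  split_ifs with hlt
  · have hs : exchWeight y y' η η' * u < exchMass y y' η η' := by
      rw [mul_comm]
      exact (lt_div_iff₀ hp.1).1 hlt
    have h := exchRate_nonneg hb (mul_pos hp.1 hu.1) hs
    rw [exchRate, mul_div_cancel_left₀ _ hp.1.ne'] at h
    linarith
  · exact le_rfl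

lemma exchLeft_eq : exchLeft (y, y', η, η')
    = exchLawLeft (exchWeight y y' η η') (exchMass y y' η η') η η' := rfl

lemma exchRight_eq : exchRight (y, y', η, η')
    = exchLawRight (exchWeight y y' η η') (exchMass y y' η η') η η' := rfl

/-- The explicit maps form an exchange pair. -/
theorem isExchange_exchLeft_exchRight : IsExchange exchLeft exchRight where
  measurable_left := measurable_exchLawLeft measurable_exchMass_subtype
  measurable_right := measurable_exchLawRight measurable_exchMass_subtype
  mem_left b hb := (exchLaw_mem_P1 hb.1 hb.2.1 (exchWeight_mem hb) (exchMass_spec hb).1).1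
  mem_right b hb := (exchLaw_mem_P1 hb.1 hb.2.1 (exchWeight_mem hb) (exchMass_spec hb).1).2
  mean_left y y' η η' hb := by
    rw [exchLeft_eq, mean_exchLawLeft hb.1 hb.2.1 (exchWeight_mem hb) (exchMass_spec hb).1,
      (exchMass_spec hb).2]
  mean_right y y' η η' hb := by
    have := hb.1.1
    have := hb.2.1.1
    have hp := exchWeight_mem hb
    obtain ⟨hq, hJ⟩ := exchMass_spec hb
    have hmix := congrArg mean (exchLaw_mixture (η := η) (η' := η') hp hq)
    have hP := exchLaw_mem_P1 hb.1 hb.2.1 hp hq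
    have hmean : ∀ m ∈ P1, ∀ m' ∈ P1,
        mean (ENNReal.ofReal (exchWeight y y' η η') • m
          + ENNReal.ofReal (1 - exchWeight y y' η η') • m')
        = exchWeight y y' η η' * mean m + (1 - exchWeight y y' η η') * mean m' := by
      intro m hm m' hm'
      rw [mean, integral_add_measure (hm.2.smul_measure ENNReal.ofReal_ne_top)
        (hm'.2.smul_measure ENNReal.ofReal_ne_top), integral_smul_measure, integral_smul_measure,
        ENNReal.toReal_ofReal hp.1.le, ENNReal.toReal_ofReal (sub_pos.2 hp.2).le]
      rfl
    rw [hmean _ hP.1 _ hP.2, hmean _ hb.1 _ hb.2.1, mean_exchLawLeft hb.1 hb.2.1 hp hq, hJ]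
      at hmix
    rw [exchRight_eq]
    have hmul := exchWeight_mul hb
    exact mul_left_cancel₀ (sub_pos.2 hp.2).ne' (by linarith)
  order_left y y' η η' hb := stochOrder_exchLawLeft hb
  order_right y y' η η' hb := by
    have := hb.1.1
    have := hb.2.1.1
    have hp := exchWeight_mem hb
    rw [exchRight_eq]
    refine stochOrder_of_rat fun t => ?_
    have h1 := (stochOrder_exchLawLeft hb).measure_Iic_le t
    have hmix := congrArg (fun m : Measure ℝ => m (Iic (t : ℝ)))
      (exchLaw_mixture (η := η) (η' := η') hp (exchMass_spec hb).1)
    simp only [Measure.coe_add, Measure.coe_smul, Pi.add_apply, Pi.smul_apply, smul_eq_mul]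
      at hmix
    -- The mixture of distribution functions is fixed, so lowering that of the first law raises that
    -- of the second.
    have h2 : ENNReal.ofReal (1 - exchWeight y y' η η') * η' (Iic (t : ℝ))
        ≤ ENNReal.ofReal (1 - exchWeight y y' η η')
          * exchLawRight (exchWeight y y' η η') (exchMass y y' η η') η η' (Iic (t : ℝ)) := by
      refine (ENNReal.add_le_add_iff_left (a := ENNReal.ofReal (exchWeight y y' η η')
        * η (Iic (t : ℝ))) (ENNReal.mul_ne_top ENNReal.ofReal_ne_top (measure_ne_top _ _))).1 ?_
      rw [← hmix]
      gcongr
    exact (ENNReal.mul_le_mul_iff_right (ENNReal.ofReal_pos.2 (sub_pos.2 hp.2)).ne'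
      ENNReal.ofReal_ne_top).1 h2
  mixture y y' η η' hb := by
    have := hb.1.1
    have := hb.2.1.1
    exact exchLaw_mixture (exchWeight_mem hb) (exchMass_spec hb).1

end Exchange

end MartRearr

end

open MeasureTheory MartRearr in
theorem mainTheorem1 (μ ν : Measure ℝ) (hμ : μ ∈ P1) (hν : ν ∈ P1)
    (hcx : ConvexOrder μ ν) (hne : μ ≠ ν)
    (π : Measure (ℝ × ℝ)) (hπ : π ∈ couplings μ ν) (hdisp : BarycentreDispersion μ π) :
    RearrangementIdentities μ ν π (rearrangement exchLeft exchRight π) ∧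
    IsExchange exchLeft exchRight ∧
    ∀ β β' : ℝ × ℝ × Measure ℝ × Measure ℝ → Measure ℝ, IsExchange β β' →
      RearrangementIdentities μ ν π (rearrangement β β' π) := by
  have h : DispersedCoupling μ ν π := ⟨hμ, hν, hcx.mean_eq hμ.2 hν.2, hπ, hdisp⟩
  exact ⟨h.rearrangementIdentities isExchange_exchLeft_exchRight, isExchange_exchLeft_exchRight,
    fun _ _ hβ => h.rearrangementIdentities hβ⟩
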